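/- Let $A$ be a generalized Cartan matrix of hyperbolic type, i.e. $A$ is indecomposable, symmetrizable, of indefinite type, and every proper principal submatrix of the corresponding symmetric matrix $B=DA$ ($D$ a positive diagonal matrix) is a direct sum of matrices of finite or affine type. Let $\alpha_1,\dots,\alpha_{n+1}$ be its simple roots, $L=\bigoplus_i\mathbb Z\alpha_i$ its root lattice with the invariant form $(\alpha_i|\alpha_j)=B_{ij}$, $W$ its Weyl group, and $\Delta=\Delta^{re}\cup\Delta^{im}$ its root system, where $\Delta^{re}=\bigcup_i W\alpha_i$ and $\Delta^{im}=\{\alpha\in L\setminus\{0\} : (\alpha|\alpha)\le 0\}$. Let $\Delta_1\subset\Delta$ be the root system of a generalized Cartan matrix $A_1$ of hyperbolic type whose root lattice $L_1\subset L$ has the same rank as $L$ and whose invariant form is, up to a positive factor, the restriction of $(\cdot|\cdot)$ to $L_1$; write $\Delta_1^{re}$ for its real roots and let $W_1$ be its Weyl group, i.e. the group of automorphisms of $L$ generated by the reflections in the simple roots of $\Delta_1$. Let $F$ and $F_1$ be fundamental chambers of $W$ and $W_1$, and suppose that the decomposition $(F,F_1)$ of $F_1$ into copies of $F$ is minimal,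 i.e. that $W_1$ is a maximal proper reflection subgroup of $W$: $W_1\subsetneq W$, and no subgroup of $W$ generated by reflections lies strictly between $W_1$ and $W$. Then the following four conditions are equivalent: (i) $L_1$ is a proper sublattice of $L$, i.e. $L_1\neq L$; (ii) $\Delta_1=\Delta\cap L_1$; (iii) $\Delta_1$ is a root subsystem of $\Delta$, i.e. if $\alpha,\beta\in\Delta_1$ and $\alpha+\beta\in\Delta$, then $\alpha+\beta\in\Delta_1$; (iv) if $\alpha,\beta\in\Delta_1^{re}$ and $\alpha+\beta\in\Delta^{re}$, then $\alpha+\beta\in\Delta_1^{re}$. -/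

import Mathlib

/-! Root lattices are written in coordinates with respect to the simple roots: for a generalized
Cartan matrix `A` indexed by `ι`, the root lattice is `ι → ℤ` and the simple root `α_i` is
`Pi.single i 1`. -/

namespace HypRoot

variable {ι κ : Type*} [Fintype ι] [DecidableEq ι] [Fintype κ] [DecidableEq κ]

/-- Generalized Cartan matrix. -/
structure IsGCM (A : Matrix ι ι ℤ) : Prop where
  diag : ∀ i, A i i = 2
  offDiag : ∀ i j, i ≠ j → A i j ≤ 0
  zero : ∀ i j, A i j = 0 → A j i = 0

/-- The principal submatrix of `A` on `S` is indecomposable: `S` does not split into two nonempty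
parts without links between them. -/
def IndecomposableOn (A : Matrix ι ι ℤ) (S : Finset ι) : Prop :=
  ∀ T ⊆ S, T.Nonempty → T ≠ S → ∃ i ∈ T, ∃ j ∈ S \ T, A i j ≠ 0 ∨ A j i ≠ 0

/-- `d` is the diagonal of a positive diagonal matrix `D` such that `D A` is symmetric. -/
structure IsSymmetrizer (A : Matrix ι ι ℤ) (d : ι → ℝ) : Prop where
  pos : ∀ i, 0 < d i
  symm : ∀ i j, d i * (A i j : ℝ) = d j * (A j i : ℝ)

/-- The symmetric matrix `B = D A` corresponding to `A`. -/
def symMatrix (A : Matrix ι ι ℤ) (d : ι → ℝ) : Matrix ι ι ℝ :=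
  Matrix.of fun i j => d i * (A i j : ℝ)

/-- The principal submatrix of `B` on `S`. -/
def principal (B : Matrix ι ι ℝ) (S : Finset ι) : Matrix S S ℝ :=
  B.submatrix Subtype.val Subtype.val

/-- Finite type, for the symmetric matrix of an indecomposable generalized Cartan matrix. -/
def IsFiniteType (B : Matrix κ κ ℝ) : Prop := B.PosDef

/-- Affine type, for the symmetric matrix of an indecomposable generalized Cartan matrix. -/
def IsAffineType (B : Matrix κ κ ℝ) : Prop :=
  B.PosSemidef ∧ B.rank + 1 = Fintype.card κ

/-- Indefinite type, for the symmetric matrix of an indecomposable generalized Cartan matrix. -/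
def IsIndefiniteType (B : Matrix κ κ ℝ) : Prop :=
  ¬ IsFiniteType B ∧ ¬ IsAffineType B

/-- `A` is a generalized Cartan matrix of hyperbolic type, with symmetrizer `d`: it is
indecomposable, symmetrizable, of indefinite type, and every proper principal submatrix of the
corresponding symmetric matrix is (a direct sum of matrices) of finite or affine type. -/
structure IsHyperbolic (A : Matrix ι ι ℤ) (d : ι → ℝ) : Prop where
  gcm : IsGCM A
  indecomposable : IndecomposableOn A Finset.univ
  symmetrizer : IsSymmetrizer A d
  indefinite : IsIndefiniteType (symMatrix A d)
  proper_sub : ∀ S : Finset ι, S ≠ Finset.univ → IndecomposableOn A S →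
    IsFiniteType (principal (symMatrix A d) S) ∨ IsAffineType (principal (symMatrix A d) S)

/-- The invariant form `(x | y)` on the root lattice; `(α_i | α_j) = d_i A_ij`. -/
noncomputable def form (A : Matrix ι ι ℤ) (d : ι → ℝ) (x y : ι → ℤ) : ℝ :=
  ∑ i, ∑ j, (x i : ℝ) * symMatrix A d i j * (y j : ℝ)

/-- The simple root `α_i`. -/
def simpleRoot (i : ι) : ι → ℤ := Pi.single i 1

/-- The Weyl group of `A`, acting on the root lattice: it is generated by the simple reflections
`x ↦ x - ⟨x, α_i^∨⟩ α_i`, where `⟨α_j, α_i^∨⟩ = A_ij`. -/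
def weylGroup (A : Matrix ι ι ℤ) : Subgroup ((ι → ℤ) ≃ₗ[ℤ] (ι → ℤ)) :=
  Subgroup.closure {w | ∃ i, ∀ x, w x = x - (∑ j, A i j * x j) • simpleRoot i}

/-- Real roots. -/
def realRoots (A : Matrix ι ι ℤ) : Set (ι → ℤ) :=
  {x | ∃ w ∈ weylGroup A, ∃ i, x = w (simpleRoot i)}

/-- Imaginary roots of a hyperbolic root system. -/
def imagRoots (A : Matrix ι ι ℤ) (d : ι → ℝ) : Set (ι → ℤ) :=
  {x | x ≠ 0 ∧ form A d x x ≤ 0}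

/-- The hyperbolic root system `Δ(A)`. -/
def roots (A : Matrix ι ι ℤ) (d : ι → ℝ) : Set (ι → ℤ) :=
  realRoots A ∪ imagRoots A d

/-- `w` is the orthogonal reflection of the root lattice in the mirror orthogonal to the lattice
vector `v` of positive square, i.e. a reflection of the hyperbolic space. -/
def IsReflectionIn (A : Matrix ι ι ℤ) (d : ι → ℝ) (v : ι → ℤ)
    (w : (ι → ℤ) ≃ₗ[ℤ] (ι → ℤ)) : Prop :=
  0 < form A d v v ∧
    ∀ x i, ((w x i : ℤ) : ℝ) = (x i : ℝ) - 2 * form A d x v / form A d v v * (v i : ℝ)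

/-- The group generated by the reflections in the vectors of `S`. -/
def reflectionGroup (A : Matrix ι ι ℤ) (d : ι → ℝ) (S : Set (ι → ℤ)) :
    Subgroup ((ι → ℤ) ≃ₗ[ℤ] (ι → ℤ)) :=
  Subgroup.closure {w | ∃ v ∈ S, IsReflectionIn A d v w}

/-- `G` is generated by reflections. (A reflection that preserves the lattice has a normal vector
in the lattice.) -/
def IsReflectionGroup (A : Matrix ι ι ℤ) (d : ι → ℝ)
    (G : Subgroup ((ι → ℤ) ≃ₗ[ℤ] (ι → ℤ))) : Prop :=
  ∃ R : Set ((ι → ℤ) ≃ₗ[ℤ] (ι → ℤ)),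
    (∀ w ∈ R, ∃ v, IsReflectionIn A d v w) ∧ G = Subgroup.closure R

/-- `Δ(A₁)`, transported by `φ`, is a hyperbolic root system contained in `Δ(A)` whose root lattice
`L₁ = range φ` is a maximal rank sublattice of the root lattice of `A`; the invariant form of
`Δ(A₁)` is, up to a positive factor, the restriction of the one of `Δ(A)`. -/
structure IsRootSystemIn (A : Matrix ι ι ℤ) (d : ι → ℝ) (A₁ : Matrix κ κ ℤ) (d₁ : κ → ℝ)
    (φ : (κ → ℤ) →ₗ[ℤ] (ι → ℤ)) : Prop where
  injective : Function.Injective φ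
  form_eq : ∃ c : ℝ, 0 < c ∧ ∀ x y, form A d (φ x) (φ y) = c * form A₁ d₁ x y
  subset : φ '' roots A₁ d₁ ⊆ roots A d
  maxRank : Module.finrank ℤ (LinearMap.range φ) = Module.finrank ℤ (ι → ℤ)

/-- The Weyl group of `Δ₁ ⊆ Δ(A)` as a group of automorphisms of the root lattice of `A`: it is
generated by the reflections in the facets of the fundamental chamber `F₁`, i.e. in the simple
roots of `Δ₁`. -/
def subWeylGroup (A : Matrix ι ι ℤ) (d : ι → ℝ) (φ : (κ → ℤ) →ₗ[ℤ] (ι → ℤ)) :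
    Subgroup ((ι → ℤ) ≃ₗ[ℤ] (ι → ℤ)) :=
  reflectionGroup A d (Set.range fun j : κ => φ (simpleRoot j))

/-- The decomposition of the chamber `F₁` of `Δ₁` into copies of the chamber `F` of `Δ(A)` is
minimal: the Weyl group of `Δ₁` is a maximal proper reflection subgroup of the Weyl group of
`Δ(A)`. -/
def IsMinimalDecomposition (A : Matrix ι ι ℤ) (d : ι → ℝ) (φ : (κ → ℤ) →ₗ[ℤ] (ι → ℤ)) : Prop :=
  subWeylGroup A d φ < weylGroup A ∧
    ∀ G, IsReflectionGroup A d G → subWeylGroup A d φ ≤ G → G < weylGroup A →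
      G = subWeylGroup A d φ

/-- The closure condition for `Δ₁ ⊆ Δ`: if `α, β ∈ Δ₁` and `α + β ∈ Δ`, then `α + β ∈ Δ₁`. -/
def ClosedIn {M : Type*} [Add M] (Δ₁ Δ : Set M) : Prop :=
  ∀ α ∈ Δ₁, ∀ β ∈ Δ₁, α + β ∈ Δ → α + β ∈ Δ₁

end HypRoot

/-!
Suppose `L₁ ≠ L`. Fix a generic point of hyperbolic space and a reflection-stable set `R` of real
roots. The parity of the number of mirrors of roots outside `R` which separate the point from its
image under `g` is additive in `g`; it is even for the reflections in `R` and odd for the reflection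
in a root outside `R`. So the group generated by the reflections in `R` contains no other
reflections. For `R = Δ^re ∩ L₁` it is therefore a proper subgroup of `W`, hence equal to `W₁` by
minimality; for `R = Δ₁^re` it is `W₁` itself, so that `Δ^re ∩ L₁ = Δ₁^re`.

Conversely, suppose `L₁ = L` and `Δ₁^re` is closed in `Δ^re`. A real root outside `Δ₁^re`, written
in the simple roots of `Δ₁`, has coordinates of one sign: otherwise subtracting a simple root, or
reflecting in it, gives a smaller real root outside `Δ₁^re` with mixed signs, since in the
hyperbolic case vectors with mixed signs have positive square. Now reflecting in simple roots of
`Δ₁` decreases such a root forever, so there is none, and `W₁ = W`.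
-/

namespace HypRoot

open scoped Matrix

section Bilinear

variable {E : Type*} [AddCommGroup E] [Module ℝ E] {B : LinearMap.BilinForm ℝ E}

theorem bilinForm_add_smul_self (hB : B.IsSymm) (x y : E) (t : ℝ) :
    B (x + t • y) (x + t • y) = B x x + 2 * t * B x y + t ^ 2 * B y y := by
  simp only [map_add, map_smul, LinearMap.add_apply, LinearMap.smul_apply, smul_eq_mul, hB.eq y x]
  ring

theorem bilinForm_eq_zero_of_forall_nonneg (hB : B.IsSymm) {x y : E} (hx : B x x = 0)
    (h : ∀ t : ℝ, 0 ≤ B (x + t • y) (x + t • y)) : B x y = 0 := by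
  have hdiscrim : discrim (B y y) (2 * B x y) 0 ≤ 0 := discrim_le_zero fun t => by
    have := h t
    rw [bilinForm_add_smul_self hB, hx] at this
    linarith
  rw [discrim] at hdiscrim
  nlinarith

end Bilinear

/-! ### The invariant form on the real span of the root lattice -/

section RealForm

variable {ι : Type*} {A : Matrix ι ι ℤ} {d : ι → ℝ}

namespace IsSymmetrizer

theorem symMatrix_comm (hd : IsSymmetrizer A d) (i j : ι) :
    symMatrix A d i j = symMatrix A d j i := hd.symm i j

theorem isHermitian_symMatrix (hd : IsSymmetrizer A d) : (symMatrix A d).IsHermitian :=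
  Matrix.IsHermitian.ext fun i j => hd.symMatrix_comm j i

theorem symMatrix_nonpos (hd : IsSymmetrizer A d) (hA : IsGCM A) {i j : ι} (hij : i ≠ j) :
    symMatrix A d i j ≤ 0 :=
  mul_nonpos_of_nonneg_of_nonpos (hd.pos i).le (by exact_mod_cast hA.offDiag i j hij)

end IsSymmetrizer

variable [Fintype ι]

/-- The real bilinear extension of the invariant form. -/
noncomputable def realForm (A : Matrix ι ι ℤ) (d : ι → ℝ) : LinearMap.BilinForm ℝ (ι → ℝ) :=
  (dotProductBilin ℝ ℝ).compl₂ (symMatrix A d).mulVecLin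

theorem realForm_eq_dotProduct (x y : ι → ℝ) :
    realForm A d x y = x ⬝ᵥ symMatrix A d *ᵥ y := rfl

theorem realForm_apply (x y : ι → ℝ) :
    realForm A d x y = ∑ i, ∑ j, x i * symMatrix A d i j * y j := by
  simp only [realForm_eq_dotProduct, dotProduct, Matrix.mulVec, Finset.mul_sum, mul_assoc]

theorem realForm_single_left [DecidableEq ι] (i : ι) (y : ι → ℝ) :
    realForm A d (Pi.single i 1) y = ∑ j, symMatrix A d i j * y j := by
  rw [realForm_eq_dotProduct, single_one_dotProduct, Matrix.mulVec, dotProduct]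

theorem realForm_eq_sum [DecidableEq ι] (x y : ι → ℝ) :
    realForm A d x y = ∑ i, x i * realForm A d (Pi.single i 1) y := by
  simp_rw [realForm_single_left, realForm_apply, Finset.mul_sum, mul_assoc]

theorem realForm_eq_zero_of_unlinked {x y : ι → ℝ}
    (h : ∀ i j, x i ≠ 0 → y j ≠ 0 → A i j = 0) : realForm A d x y = 0 := by
  rw [realForm_apply]
  refine Finset.sum_eq_zero fun i _ => Finset.sum_eq_zero fun j _ => ?_
  by_cases hi : x i = 0
  · simp [hi]
  by_cases hj : y j = 0
  · simp [hj]
  simp [symMatrix, h i j hi hj]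

theorem realForm_self_eq_principal {S : Finset ι} {x : ι → ℝ} (hx : ∀ i ∉ S, x i = 0) :
    realForm A d x x =
      (fun i : S => x i) ⬝ᵥ principal (symMatrix A d) S *ᵥ fun i : S => x i := by
  have sum_eq {f : ι → ℝ} (hf : ∀ i ∉ S, f i = 0) : ∑ i, f i = ∑ i : S, f i := by
    rw [Finset.sum_coe_sort S f]
    exact (Finset.sum_subset (Finset.subset_univ _) fun i _ hi => hf i hi).symm
  rw [realForm_eq_dotProduct, dotProduct, sum_eq fun i hi => by rw [hx i hi, zero_mul]]
  refine Finset.sum_congr rfl fun i _ => congrArg (x i * ·) ?_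
  exact sum_eq fun j hj => by rw [hx j hj, mul_zero]

namespace IsSymmetrizer

theorem isSymm_realForm (hd : IsSymmetrizer A d) : (realForm A d).IsSymm where
  eq x y := by
    simp only [realForm_apply]
    rw [Finset.sum_comm]
    refine Finset.sum_congr rfl fun i _ => Finset.sum_congr rfl fun j _ => ?_
    rw [hd.symMatrix_comm j i]
    ring

theorem realForm_comm (hd : IsSymmetrizer A d) (x y : ι → ℝ) :
    realForm A d x y = realForm A d y x := hd.isSymm_realForm.eq x y

theorem realForm_abs_le (hd : IsSymmetrizer A d) (hA : IsGCM A) (x : ι → ℝ) :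
    realForm A d |x| |x| ≤ realForm A d x x := by
  rw [realForm_apply, realForm_apply]
  refine Finset.sum_le_sum fun i _ => Finset.sum_le_sum fun j _ => ?_
  simp only [Pi.abs_apply]
  rcases eq_or_ne i j with rfl | hij
  · rw [mul_right_comm, abs_mul_abs_self, mul_right_comm]
  · have hle : x i * x j ≤ |x i| * |x j| := (le_abs_self _).trans_eq (abs_mul _ _)
    nlinarith [hd.symMatrix_nonpos hA hij]

variable [DecidableEq ι]

theorem eq_zero_of_realForm_single_nonneg (hd : IsSymmetrizer A d) (hA : IsGCM A)
    {x : ι → ℝ} (hx : 0 ≤ x) {l : ι} (hl : x l = 0) (h : 0 ≤ realForm A d (Pi.single l 1) x)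
    {i : ι} (hi : x i ≠ 0) : A l i = 0 := by
  have term_nonpos (k : ι) (_ : k ∈ Finset.univ) : symMatrix A d l k * x k ≤ 0 := by
    rcases eq_or_ne l k with rfl | hlk
    · rw [hl, mul_zero]
    · exact mul_nonpos_of_nonpos_of_nonneg (hd.symMatrix_nonpos hA hlk) (hx k)
  rw [realForm_single_left] at h
  have hterm : symMatrix A d l i * x i = 0 :=
    (Finset.sum_eq_zero_iff_of_nonpos term_nonpos).1
      (le_antisymm (Finset.sum_nonpos term_nonpos) h) i (Finset.mem_univ i)
  simpa [symMatrix, (hd.pos l).ne', hi] using hterm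

theorem apply_ne_zero_of_realForm_single_nonneg (hd : IsSymmetrizer A d) (hA : IsGCM A)
    (hind : IndecomposableOn A Finset.univ) {x : ι → ℝ} (hx : 0 ≤ x) (hx0 : x ≠ 0)
    (h : ∀ l, x l = 0 → 0 ≤ realForm A d (Pi.single l 1) x) (l : ι) : x l ≠ 0 := by
  intro hl
  let T : Finset ι := {i | x i ≠ 0}
  have mem_T {i : ι} : i ∈ T ↔ x i ≠ 0 := by simp [T]
  have hTne : T.Nonempty := (Function.ne_iff.1 hx0).imp fun i hi => mem_T.2 hi
  have hTuniv : T ≠ Finset.univ := fun hT => mem_T.1 (hT ▸ Finset.mem_univ l) hl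
  obtain ⟨i, hi, j, hj, hij⟩ := hind T (Finset.subset_univ T) hTne hTuniv
  have hxj : x j = 0 := by simpa [T] using hj
  have hji : A j i = 0 :=
    hd.eq_zero_of_realForm_single_nonneg hA hx hxj (h j hxj) (mem_T.1 hi)
  exact hij.elim (· (hA.zero _ _ hji)) (· hji)

end IsSymmetrizer

end RealForm

/-! ### The Lorentzian geometry of a hyperbolic matrix -/

namespace IsHyperbolic

variable {ι : Type*} [Fintype ι] [DecidableEq ι] {A : Matrix ι ι ℤ} {d : ι → ℝ}

theorem realForm_nonneg_of_support (hA : IsHyperbolic A d) {S : Finset ι} (hS : S ≠ Finset.univ)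
    {x : ι → ℝ} (hx : ∀ i ∉ S, x i = 0) : 0 ≤ realForm A d x x := by
  induction S using Finset.strongInduction generalizing x with
  | H S ih =>
  by_cases hind : IndecomposableOn A S
  · have hpsd : (principal (symMatrix A d) S).PosSemidef :=
      (hA.proper_sub S hS hind).elim (fun h => Matrix.PosDef.posSemidef h) And.left
    rw [realForm_self_eq_principal hx]
    simpa using hpsd.dotProduct_mulVec_nonneg fun i : S => x i
  · obtain ⟨T, hTS, hTne, hT, hlink⟩ : ∃ T ⊆ S, T.Nonempty ∧ T ≠ S ∧
        ∀ i ∈ T, ∀ j ∈ S \ T, A i j = 0 ∧ A j i = 0 := by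
      simp only [IndecomposableOn] at hind
      push Not at hind
      exact hind
    have hTS' : T ⊂ S := hTS.ssubset_of_ne hT
    have hST : S \ T ⊂ S := Finset.sdiff_ssubset hTS hTne
    set y : ι → ℝ := (T : Set ι).indicator x with hy
    set z : ι → ℝ := (T : Set ι)ᶜ.indicator x with hz
    have hy0 : 0 ≤ realForm A d y y :=
      ih T hTS' (fun h => hTS'.2 (h ▸ Finset.subset_univ S)) fun i hi => by simp [hy, hi]
    have hzsupp (i : ι) (hi : i ∉ S \ T) : z i = 0 := by
      by_cases hiT : i ∈ T
      · simp [hz, hiT]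
      · simp [hz, hiT, hx i fun hiS => hi (Finset.mem_sdiff.2 ⟨hiS, hiT⟩)]
    have hz0 : 0 ≤ realForm A d z z :=
      ih (S \ T) hST (fun h => hST.2 (h ▸ Finset.subset_univ S)) hzsupp
    have hyz : realForm A d y z = 0 := realForm_eq_zero_of_unlinked fun i j hi hj =>
      (hlink i (Set.mem_of_indicator_ne_zero hi) j (not_imp_comm.1 (hzsupp j) hj)).1
    have hsum := bilinForm_add_smul_self hA.symmetrizer.isSymm_realForm y z 1
    rw [one_smul, Set.indicator_self_add_compl, hyz] at hsum
    linarith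

theorem realForm_nonneg (hA : IsHyperbolic A d) {x : ι → ℝ} {l : ι} (hl : x l = 0) :
    0 ≤ realForm A d x x :=
  hA.realForm_nonneg_of_support (Finset.erase_ne_self.2 (Finset.mem_univ l)) fun i hi => by
    rwa [show i = l by simpa using hi]

theorem apply_ne_zero_of_realForm_neg (hA : IsHyperbolic A d) {x : ι → ℝ}
    (hx : realForm A d x x < 0) (i : ι) : x i ≠ 0 :=
  fun hi => hx.not_ge (hA.realForm_nonneg hi)

theorem eq_zero_of_realForm_eq_zero (hA : IsHyperbolic A d)
    (hpsd : ∀ x, 0 ≤ realForm A d x x) {x : ι → ℝ} (hx : realForm A d x x = 0) {l : ι}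
    (hl : x l = 0) : x = 0 := by
  by_contra hx0
  have habs : realForm A d |x| |x| = 0 :=
    le_antisymm ((hA.symmetrizer.realForm_abs_le hA.gcm x).trans_eq hx) (hpsd _)
  refine hA.symmetrizer.apply_ne_zero_of_realForm_single_nonneg hA.gcm hA.indecomposable
    (abs_nonneg x) (by simpa using hx0) (fun k _ => ?_) l (by simp [hl])
  rw [hA.symmetrizer.realForm_comm]
  exact (bilinForm_eq_zero_of_forall_nonneg hA.symmetrizer.isSymm_realForm habs
    fun t => hpsd _).ge

theorem finrank_ker_mulVecLin (hA : IsHyperbolic A d) (hpsd : ∀ x, 0 ≤ realForm A d x x)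
    {x : ι → ℝ} (hx0 : x ≠ 0) (hx : x ∈ LinearMap.ker (symMatrix A d).mulVecLin) :
    Module.finrank ℝ (LinearMap.ker (symMatrix A d).mulVecLin) = 1 := by
  obtain ⟨l, hl⟩ := Function.ne_iff.1 hx0
  rw [Pi.zero_apply] at hl
  refine finrank_eq_one ⟨x, hx⟩ (fun h => hx0 (congrArg Subtype.val h)) fun ⟨y, hy⟩ =>
    ⟨y l / x l, Subtype.ext (sub_eq_zero.1 ?_)⟩
  have hker : (y l / x l) • x - y ∈ LinearMap.ker (symMatrix A d).mulVecLin :=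
    sub_mem (Submodule.smul_mem _ _ hx) hy
  refine hA.eq_zero_of_realForm_eq_zero hpsd (l := l) ?_ (by simp [hl])
  exact (congrArg (_ ⬝ᵥ ·) (LinearMap.mem_ker.1 hker)).trans (dotProduct_zero _)

theorem exists_realForm_neg (hA : IsHyperbolic A d) : ∃ x, realForm A d x x < 0 := by
  by_contra! hpsd
  have hherm := hA.symmetrizer.isHermitian_symMatrix
  have hPSD : (symMatrix A d).PosSemidef := .of_dotProduct_mulVec_nonneg hherm hpsd
  obtain ⟨x, hx0, hx⟩ : ∃ x ≠ 0, realForm A d x x = 0 := by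
    by_contra! h
    exact hA.indefinite.1
      (.of_dotProduct_mulVec_pos hherm fun x hx0 => (hpsd x).lt_of_ne' (h x hx0))
  have hker := hA.finrank_ker_mulVecLin hpsd hx0 ((hPSD.dotProduct_mulVec_zero_iff x).1 hx)
  have hrank := (symMatrix A d).mulVecLin.finrank_range_add_finrank_ker
  rw [hker, Module.finrank_fintype_fun_eq_card] at hrank
  exact hA.indefinite.2 ⟨hPSD, hrank⟩

theorem exists_pos_realForm_neg (hA : IsHyperbolic A d) :
    ∃ p : ι → ℝ, (∀ i, 0 < p i) ∧ realForm A d p p < 0 := by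
  obtain ⟨x, hx⟩ := hA.exists_realForm_neg
  exact ⟨|x|, fun i => abs_pos.2 (hA.apply_ne_zero_of_realForm_neg hx i),
    (hA.symmetrizer.realForm_abs_le hA.gcm x).trans_lt hx⟩

theorem exists_ne (hA : IsHyperbolic A d) (i : ι) : ∃ j, j ≠ i := by
  by_contra! h
  obtain ⟨x, hx⟩ := hA.exists_realForm_neg
  have hsum : realForm A d x x = x i * (2 * d i) * x i := by
    have hi : Finset.univ = {i} := Finset.eq_singleton_iff_unique_mem.2 (by simpa using h)
    simp [realForm_apply, hi, symMatrix, hA.gcm.diag i, mul_comm (d i)]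
  nlinarith [mul_nonneg (hA.symmetrizer.pos i).le (mul_self_nonneg (x i))]

theorem realForm_pos_of_orthogonal (hA : IsHyperbolic A d) {x u : ι → ℝ}
    (hx : realForm A d x x < 0) (hu : realForm A d u x = 0) (hu0 : u ≠ 0) :
    0 < realForm A d u u := by
  obtain ⟨i, hi⟩ := Function.ne_iff.1 hu0
  rw [Pi.zero_apply] at hi
  -- The combination of `u` and `x` whose coordinate `i` vanishes has nonnegative square.
  have h := hA.realForm_nonneg (x := x i • u + (-u i) • x) (l := i) (by simp [mul_comm])
  rw [bilinForm_add_smul_self hA.symmetrizer.isSymm_realForm] at h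
  simp only [map_smul, LinearMap.smul_apply, smul_eq_mul, hu] at h
  have hui : 0 < u i ^ 2 := by positivity
  refine pos_of_mul_pos_right ?_ (sq_nonneg (x i))
  linarith [mul_neg_of_pos_of_neg hui hx]

theorem realForm_pos_of_mixed (hA : IsHyperbolic A d) {w : ι → ℝ} {i j : ι}
    (hi : 0 < w i) (hj : w j < 0) : 0 < realForm A d w w := by
  obtain ⟨p, hp, hpp⟩ := hA.exists_pos_realForm_neg
  -- On the line `w + t p` the form is concave and is nonnegative at some `t < 0` and some `t > 0`.
  have key (k : ι) : 0 ≤ realForm A d (w + (-(w k / p k)) • p) (w + (-(w k / p k)) • p) :=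
    hA.realForm_nonneg (l := k) (by simp [(hp k).ne'])
  simp only [bilinForm_add_smul_self hA.symmetrizer.isSymm_realForm] at key
  have ha : 0 < w i / p i := div_pos hi (hp i)
  have hb : w j / p j < 0 := div_neg_of_neg_of_pos hj (hp j)
  have hkeyi := key i
  have hkeyj := key j
  generalize w i / p i = a at *
  generalize w j / p j = b at *
  have hconv : 0 ≤ (a - b) * (realForm A d w w - a * b * realForm A d p p) := by
    nlinarith [mul_nonneg ha.le hkeyj, mul_nonneg (neg_pos.2 hb).le hkeyi]
  have := nonneg_of_mul_nonneg_right hconv (by linarith)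
  nlinarith [mul_pos (mul_pos ha (neg_pos.2 hb)) (neg_pos.2 hpp)]

theorem realForm_nonneg_of_mixed (hA : IsHyperbolic A d) {w : ι → ℝ} {i j : ι}
    (hi : 0 ≤ w i) (hj : w j ≤ 0) : 0 ≤ realForm A d w w := by
  rcases hi.eq_or_lt with hi | hi
  · exact hA.realForm_nonneg hi.symm
  rcases hj.eq_or_lt with hj | hj
  · exact hA.realForm_nonneg hj
  · exact (hA.realForm_pos_of_mixed hi hj).le

theorem eq_zero_of_realForm_single_eq_zero (hA : IsHyperbolic A d) {x : ι → ℝ} {l : ι}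
    (hl : x l = 0) (hx : realForm A d x x ≤ 0) (hort : realForm A d (Pi.single l 1) x = 0) :
    x = 0 := by
  have hsymm := hA.symmetrizer.isSymm_realForm
  have hxx : realForm A d x x = 0 := le_antisymm hx (hA.realForm_nonneg hl)
  have hsimple (i : ι) : realForm A d (Pi.single i 1) x = 0 := by
    rcases eq_or_ne l i with rfl | hli
    · exact hort
    · rw [hA.symmetrizer.realForm_comm]
      exact bilinForm_eq_zero_of_forall_nonneg hsymm hxx
        fun t => hA.realForm_nonneg (l := l) (by simp [hl, hli])
  obtain ⟨p, -, hp⟩ := hA.exists_pos_realForm_neg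
  have hxp : realForm A d x p = 0 := by
    rw [hA.symmetrizer.realForm_comm, realForm_eq_sum]
    simp [hsimple]
  by_contra hx0
  exact (hA.realForm_pos_of_orthogonal hp hxp hx0).ne' hxx

end IsHyperbolic

/-! ### The invariant form on the root lattice -/

section Form

variable {ι : Type*}

/-- The embedding of the root lattice into its real span. -/
def toReal : (ι → ℤ) →ₗ[ℤ] (ι → ℝ) := (Algebra.linearMap ℤ ℝ).compLeft ι

@[simp]
theorem toReal_apply (x : ι → ℤ) (i : ι) : toReal x i = (x i : ℝ) := rfl

theorem toReal_injective : Function.Injective (toReal : (ι → ℤ) → (ι → ℝ)) := fun _ _ h =>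
  funext fun i => Int.cast_injective (congrFun h i)

theorem toReal_simpleRoot [DecidableEq ι] (i : ι) : toReal (simpleRoot i) = Pi.single i (1 : ℝ) :=
  funext fun j => by simp [simpleRoot, Pi.single_apply]

theorem toReal_zsmul (n : ℤ) (x : ι → ℤ) : toReal (n • x) = (n : ℝ) • toReal x := by
  rw [map_smul, Int.cast_smul_eq_zsmul]

theorem toReal_map_of_smul {κ : Type*} [Finite ι] (f : (ι → ℤ) →ₗ[ℤ] (κ → ℤ)) {x y : ι → ℤ} {c : ℝ}
    (h : toReal x = c • toReal y) : toReal (f x) = c • toReal (f y) := by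
  classical
  have := Fintype.ofFinite ι
  have hx (j : ι) : (x j : ℝ) = c * y j := congrFun h j
  funext i
  rw [toReal_apply, Pi.smul_apply, toReal_apply, f.pi_apply_eq_sum_univ x,
    f.pi_apply_eq_sum_univ y]
  simp [hx, Finset.mul_sum, mul_assoc]

variable [Fintype ι] (A : Matrix ι ι ℤ) (d : ι → ℝ)

theorem form_eq_realForm (x y : ι → ℤ) :
    form A d x y = realForm A d (toReal x) (toReal y) := by
  rw [realForm_apply]
  rfl

theorem form_sub_left (x y z : ι → ℤ) : form A d (x - y) z = form A d x z - form A d y z := by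
  simp only [form_eq_realForm, map_sub, LinearMap.sub_apply]

theorem form_sub_right (x y z : ι → ℤ) : form A d x (y - z) = form A d x y - form A d x z := by
  simp only [form_eq_realForm, map_sub]

theorem form_neg_left (x y : ι → ℤ) : form A d (-x) y = -form A d x y := by
  simp only [form_eq_realForm, map_neg, LinearMap.neg_apply]

theorem form_neg_right (x y : ι → ℤ) : form A d x (-y) = -form A d x y := by
  simp only [form_eq_realForm, map_neg]

theorem form_zsmul_left (n : ℤ) (x y : ι → ℤ) : form A d (n • x) y = n * form A d x y := by
  rw [form_eq_realForm, toReal_zsmul, map_smul, LinearMap.smul_apply, smul_eq_mul,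
    form_eq_realForm]

variable [DecidableEq ι]

theorem form_eq_sum (x y : ι → ℤ) :
    form A d x y = ∑ i, (x i : ℝ) * form A d (simpleRoot i) y := by
  simp only [form_eq_realForm, toReal_simpleRoot]
  exact realForm_eq_sum _ _

theorem form_simpleRoot_left (i : ι) (x : ι → ℤ) :
    form A d (simpleRoot i) x = d i * (∑ j, A i j * x j : ℤ) := by
  simp [form_eq_realForm, toReal_simpleRoot, realForm_single_left, symMatrix, Finset.mul_sum,
    mul_assoc]

end Form

namespace IsSymmetrizer

variable {ι : Type*} [Fintype ι] {A : Matrix ι ι ℤ} {d : ι → ℝ}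

theorem form_comm (hd : IsSymmetrizer A d) (x y : ι → ℤ) : form A d x y = form A d y x := by
  rw [form_eq_realForm, form_eq_realForm, hd.realForm_comm]

theorem form_sub_self (hd : IsSymmetrizer A d) (x y : ι → ℤ) :
    form A d (x - y) (x - y) = form A d x x - 2 * form A d x y + form A d y y := by
  rw [form_sub_left, form_sub_right, form_sub_right, hd.form_comm y x]
  ring

end IsSymmetrizer

/-! ### Reflections -/

section Reflection

variable {ι : Type*} [Fintype ι] {A : Matrix ι ι ℤ} {d : ι → ℝ} {v : ι → ℤ}
  {s : (ι → ℤ) ≃ₗ[ℤ] (ι → ℤ)}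

theorem isReflectionIn_iff : IsReflectionIn A d v s ↔ 0 < form A d v v ∧
    ∀ x, toReal (s x) = toReal x - (2 * form A d x v / form A d v v) • toReal v :=
  and_congr_right' (forall_congr' fun _ => funext_iff.symm)

namespace IsReflectionIn

theorem toReal_eq (hs : IsReflectionIn A d v s) (x : ι → ℤ) :
    toReal (s x) = toReal x - (2 * form A d x v / form A d v v) • toReal v :=
  (isReflectionIn_iff.1 hs).2 x

theorem unique {t : (ι → ℤ) ≃ₗ[ℤ] (ι → ℤ)} (hs : IsReflectionIn A d v s)
    (ht : IsReflectionIn A d v t) : s = t :=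
  LinearEquiv.ext fun x => toReal_injective (by rw [hs.toReal_eq, ht.toReal_eq])

theorem apply_eq (hs : IsReflectionIn A d v s) {x : ι → ℤ} {m : ℤ}
    (hm : 2 * form A d x v = m * form A d v v) : s x = x - m • v := by
  apply toReal_injective
  rw [hs.toReal_eq, hm, mul_div_cancel_right₀ _ hs.1.ne', map_sub, toReal_zsmul]

theorem apply_self (hs : IsReflectionIn A d v s) : s v = -v := by
  rw [hs.apply_eq (m := 2) (by norm_num)]
  module

theorem form_map (hs : IsReflectionIn A d v s) (hd : IsSymmetrizer A d) (x y : ι → ℤ) :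
    form A d (s x) (s y) = form A d x y := by
  have hv := hs.1.ne'
  rw [form_eq_realForm, hs.toReal_eq, hs.toReal_eq]
  simp only [map_sub, map_smul, LinearMap.sub_apply, LinearMap.smul_apply, smul_eq_mul,
    ← form_eq_realForm]
  rw [hd.form_comm v y]
  field_simp
  ring

theorem apply_apply (hs : IsReflectionIn A d v s) (hd : IsSymmetrizer A d) (x : ι → ℤ) :
    s (s x) = x := by
  have hform : form A d (s x) v = -form A d x v := by
    rw [← hs.form_map hd x v, hs.apply_self, form_neg_right, neg_neg]
  apply toReal_injective
  rw [hs.toReal_eq, hs.toReal_eq, hform]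
  module

theorem conj (hs : IsReflectionIn A d v s) {g : (ι → ℤ) ≃ₗ[ℤ] (ι → ℤ)}
    (hg : ∀ x y, form A d (g x) (g y) = form A d x y) :
    IsReflectionIn A d (g v) (g * s * g⁻¹) := by
  refine isReflectionIn_iff.2 ⟨(hg v v).symm ▸ hs.1, fun x => ?_⟩
  obtain ⟨y, rfl⟩ := g.surjective x
  have hsy : toReal (s y - y) = (-(2 * form A d y v / form A d v v)) • toReal v := by
    rw [map_sub, hs.toReal_eq]
    module
  have hgsy : toReal (g (s y)) - toReal (g y) =
      (-(2 * form A d y v / form A d v v)) • toReal (g v) := by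
    rw [← map_sub, ← map_sub]
    exact toReal_map_of_smul g.toLinearMap hsy
  rw [hg, hg]
  change toReal (g (s (g.symm (g y)))) = toReal (g y) - _ • toReal (g v)
  rw [g.symm_apply_apply, sub_eq_iff_eq_add.1 hgsy]
  module

end IsReflectionIn

end Reflection

/-! ### The Weyl group and the real roots -/

section WeylGroup

variable {ι : Type*} [Fintype ι] [DecidableEq ι] {A : Matrix ι ι ℤ} {d : ι → ℝ}

theorem map_mem_realRoots {g : (ι → ℤ) ≃ₗ[ℤ] (ι → ℤ)} (hg : g ∈ weylGroup A)
    {x : ι → ℤ} (hx : x ∈ realRoots A) : g x ∈ realRoots A := by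
  obtain ⟨w, hw, i, rfl⟩ := hx
  exact ⟨g * w, mul_mem hg hw, i, rfl⟩

theorem simpleRoot_mem_realRoots (A : Matrix ι ι ℤ) (i : ι) : simpleRoot i ∈ realRoots A :=
  ⟨1, one_mem _, i, rfl⟩

theorem dvd_of_zsmul_eq_zsmul_of_mem_realRoots {x y : ι → ℤ} (hx : x ∈ realRoots A) {m n : ℤ}
    (h : m • y = n • x) : m ∣ n := by
  obtain ⟨w, -, i, rfl⟩ := hx
  refine ⟨w.symm y i, ?_⟩
  have hi := congrFun (congrArg w.symm h) i
  simpa only [map_smul, w.symm_apply_apply, Pi.smul_apply, simpleRoot, Pi.single_eq_same,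
    smul_eq_mul, mul_one] using hi.symm

theorem IsGCM.form_simpleRoot_self (hA : IsGCM A) (d : ι → ℝ) (i : ι) :
    form A d (simpleRoot i) (simpleRoot i) = 2 * d i := by
  rw [form_simpleRoot_left]
  simp [simpleRoot, Pi.single_apply, hA.diag i, mul_comm]

/-- The simple reflection in `α_i`, as an automorphism of the root lattice. -/
def simpleReflection (hA : IsGCM A) (i : ι) : (ι → ℤ) ≃ₗ[ℤ] (ι → ℤ) :=
  LinearEquiv.ofInvolutive
    { toFun := fun x => x - (∑ j, A i j * x j) • simpleRoot i
      map_add' := fun x y => by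
        simp only [Pi.add_apply, mul_add, Finset.sum_add_distrib]
        module
      map_smul' := fun c x => by
        simp only [Pi.smul_apply, smul_eq_mul, mul_left_comm _ c, ← Finset.mul_sum,
          RingHom.id_apply]
        module }
    fun x => by
      have h : ∑ j, A i j * simpleRoot i j = 2 := by simp [simpleRoot, Pi.single_apply, hA.diag i]
      simp only [LinearMap.coe_mk, AddHom.coe_mk, Pi.sub_apply, Pi.smul_apply, smul_eq_mul,
        mul_sub, Finset.sum_sub_distrib, mul_left_comm _ (∑ j, A i j * x j), ← Finset.mul_sum, h]
      module

theorem simpleReflection_mem_weylGroup (hA : IsGCM A) (i : ι) :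
    simpleReflection hA i ∈ weylGroup A :=
  Subgroup.subset_closure ⟨i, fun _ => rfl⟩

namespace IsSymmetrizer

theorem isReflectionIn_simpleRoot (hd : IsSymmetrizer A d) (hA : IsGCM A) {i : ι}
    {w : (ι → ℤ) ≃ₗ[ℤ] (ι → ℤ)} (hw : ∀ x, w x = x - (∑ j, A i j * x j) • simpleRoot i) :
    IsReflectionIn A d (simpleRoot i) w := by
  have hdi := hd.pos i
  refine ⟨by rw [hA.form_simpleRoot_self d]; positivity, fun x k => ?_⟩
  rw [hw, hd.form_comm, form_simpleRoot_left, hA.form_simpleRoot_self]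
  simp only [Pi.sub_apply, Pi.smul_apply, smul_eq_mul, Int.cast_sub, Int.cast_mul]
  field_simp

theorem form_map_of_mem_weylGroup (hd : IsSymmetrizer A d) (hA : IsGCM A)
    {g : (ι → ℤ) ≃ₗ[ℤ] (ι → ℤ)} (hg : g ∈ weylGroup A) (x y : ι → ℤ) :
    form A d (g x) (g y) = form A d x y := by
  induction hg using Subgroup.closure_induction generalizing x y with
  | mem w hw =>
    obtain ⟨i, hi⟩ := hw
    exact (hd.isReflectionIn_simpleRoot hA hi).form_map hd x y
  | one => rfl
  | mul g h _ _ ihg ihh => exact (ihg _ _).trans (ihh x y)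
  | inv g _ ih =>
    rw [← ih, ← LinearEquiv.mul_apply, ← LinearEquiv.mul_apply, mul_inv_cancel]
    rfl

theorem exists_form_eq_of_mem_realRoots (hd : IsSymmetrizer A d) (hA : IsGCM A) {v : ι → ℤ}
    (hv : v ∈ realRoots A) : ∃ i, form A d v v = 2 * d i := by
  obtain ⟨w, hw, i, rfl⟩ := hv
  exact ⟨i, by rw [hd.form_map_of_mem_weylGroup hA hw, hA.form_simpleRoot_self]⟩

theorem form_pos_of_mem_realRoots (hd : IsSymmetrizer A d) (hA : IsGCM A) {v : ι → ℤ}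
    (hv : v ∈ realRoots A) : 0 < form A d v v := by
  obtain ⟨i, hi⟩ := hd.exists_form_eq_of_mem_realRoots hA hv
  linarith [hd.pos i]

theorem exists_isReflectionIn (hd : IsSymmetrizer A d) (hA : IsGCM A) {v : ι → ℤ}
    (hv : v ∈ realRoots A) : ∃ s ∈ weylGroup A, IsReflectionIn A d v s := by
  obtain ⟨w, hw, i, rfl⟩ := hv
  exact ⟨w * simpleReflection hA i * w⁻¹,
    mul_mem (mul_mem hw (simpleReflection_mem_weylGroup hA i)) (inv_mem hw),
    (hd.isReflectionIn_simpleRoot hA fun _ => rfl).conj (hd.form_map_of_mem_weylGroup hA hw)⟩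

theorem reflection_mem_weylGroup (hd : IsSymmetrizer A d) (hA : IsGCM A) {v : ι → ℤ}
    (hv : v ∈ realRoots A) {s : (ι → ℤ) ≃ₗ[ℤ] (ι → ℤ)} (hs : IsReflectionIn A d v s) :
    s ∈ weylGroup A := by
  obtain ⟨t, ht, htv⟩ := hd.exists_isReflectionIn hA hv
  rwa [hs.unique htv]

theorem neg_mem_realRoots (hd : IsSymmetrizer A d) (hA : IsGCM A) {v : ι → ℤ}
    (hv : v ∈ realRoots A) : -v ∈ realRoots A := by
  obtain ⟨s, hs, hsv⟩ := hd.exists_isReflectionIn hA hv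
  exact hsv.apply_self ▸ map_mem_realRoots hs hv

theorem exists_pairing (hd : IsSymmetrizer A d) (hA : IsGCM A) {v : ι → ℤ}
    (hv : v ∈ realRoots A) (x : ι → ℤ) : ∃ m : ℤ, 2 * form A d x v = m * form A d v v := by
  obtain ⟨w, hw, i, rfl⟩ := hv
  obtain ⟨y, rfl⟩ := w.surjective x
  refine ⟨∑ j, A i j * y j, ?_⟩
  rw [hd.form_map_of_mem_weylGroup hA hw, hd.form_map_of_mem_weylGroup hA hw, hd.form_comm,
    form_simpleRoot_left, hA.form_simpleRoot_self]
  ring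

theorem sub_zsmul_mem_realRoots (hd : IsSymmetrizer A d) (hA : IsGCM A) {v x : ι → ℤ}
    (hv : v ∈ realRoots A) (hx : x ∈ realRoots A) {m : ℤ}
    (hm : 2 * form A d x v = m * form A d v v) : x - m • v ∈ realRoots A := by
  obtain ⟨s, hs, hsv⟩ := hd.exists_isReflectionIn hA hv
  exact hsv.apply_eq hm ▸ map_mem_realRoots hs hx

theorem eq_or_eq_neg_of_reflection (hd : IsSymmetrizer A d) (hA : IsGCM A) {u v : ι → ℤ}
    (hu : u ∈ realRoots A) (hv : v ∈ realRoots A) {s : (ι → ℤ) ≃ₗ[ℤ] (ι → ℤ)}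
    (hs : IsReflectionIn A d v s) (hsu : s u = -u) : u = v ∨ u = -v := by
  obtain ⟨m, hm⟩ := hd.exists_pairing hA hv u
  rw [hs.apply_eq hm] at hsu
  have huv : (2 : ℤ) • u = m • v := by linear_combination (exp := 1) hsu
  have hassoc : Associated m 2 := associated_of_dvd_dvd
    (dvd_of_zsmul_eq_zsmul_of_mem_realRoots hu huv.symm)
    (dvd_of_zsmul_eq_zsmul_of_mem_realRoots hv huv)
  have two_inj := smul_right_injective (ι → ℤ) (two_ne_zero (α := ℤ))
  rcases Int.associated_iff.1 hassoc with rfl | rfl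
  · exact Or.inl (two_inj huv)
  · exact Or.inr (two_inj (by simpa using huv))

end IsSymmetrizer

end WeylGroup

/-! ### The parity of the number of inversions -/

theorem even_ncard_of_involution {α : Type*} {s : Set α} (hs : s.Finite) {σ : α → α}
    (hσ : ∀ a ∈ s, σ a ∈ s) (hσσ : ∀ a ∈ s, σ (σ a) = a) (hne : ∀ a ∈ s, σ a ≠ a) :
    Even s.ncard := by
  lift s to Finset α using hs
  rw [Set.ncard_coe_finset, ← ZMod.natCast_eq_zero_iff_even, ← nsmul_one, ← Finset.sum_const]
  exact Finset.sum_involution (fun a _ => σ a) (fun _ _ => CharTwo.add_self_eq_zero 1)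
    (fun a ha _ => hne a ha) hσ hσσ

section Inversions

variable {R M S : Type*} [Semiring R] [AddCommGroup M] [Module R M]
  [AddCommGroup S] [LinearOrder S] [IsOrderedAddMonoid S] {X : Set M} {f : M → S}
  {g h : M ≃ₗ[R] M}

/-- The positive elements of `X` that `g` sends to negative ones, positivity being measured by `f`.
For a set `X` of roots and `f = (· | x)` these are the normal vectors, one for each mirror, of the
mirrors separating `x` from `g⁻¹ x`. -/
def inversions (X : Set M) (f : M → S) (g : M ≃ₗ[R] M) : Set M :=
  {α ∈ X | 0 < f α ∧ f (g α) < 0}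

theorem inversions_inv (hf : f.Odd) (hX : ∀ α ∈ X, -α ∈ X) (hg : ∀ α, g α ∈ X ↔ α ∈ X) :
    inversions X f g⁻¹ = (fun α => -g α) '' inversions X f g := by
  ext β
  constructor
  · rintro ⟨hβ, hpos, hneg⟩
    have hgβ : g (g⁻¹ β) = β := g.apply_symm_apply β
    refine ⟨-g⁻¹ β, ⟨hX _ ((hg _).1 (hgβ.symm ▸ hβ)), ?_, ?_⟩, ?_⟩
    · rwa [hf, Left.neg_pos_iff]
    · rwa [map_neg, hgβ, hf, Left.neg_neg_iff]
    · simp only [map_neg, hgβ, neg_neg]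
  · rintro ⟨α, ⟨hα, hpos, hneg⟩, rfl⟩
    have hgα : g⁻¹ (-g α) = -α := by rw [map_neg]; exact congrArg _ (g.symm_apply_apply α)
    refine ⟨hX _ ((hg α).2 hα), ?_, ?_⟩
    · rwa [hf, Left.neg_pos_iff]
    · rwa [hgα, hf, Left.neg_neg_iff]

theorem inversions_eq_union (hf : f.Odd) (hX : ∀ α ∈ X, -α ∈ X) (hX0 : ∀ α ∈ X, f α ≠ 0)
    (hg : ∀ α, g α ∈ X ↔ α ∈ X) (hh : ∀ α, h α ∈ X ↔ α ∈ X) :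
    inversions X f g = h '' (inversions X f (g * h) \ inversions X f h) ∪
      (fun α => -h α) '' (inversions X f h \ inversions X f (g * h)) := by
  ext β
  constructor
  · rintro ⟨hβ, hpos, hneg⟩
    obtain ⟨α, rfl⟩ := h.surjective β
    have hα : α ∈ X := (hh α).1 hβ
    rcases (hX0 α hα).lt_or_gt with hfα | hfα
    · refine Or.inr ⟨-α, ⟨⟨hX α hα, ?_, ?_⟩, fun hinv => hneg.not_gt ?_⟩, by simp⟩
      · rwa [hf, Left.neg_pos_iff]
      · rwa [map_neg, hf, Left.neg_neg_iff]
      · simpa [hf _] using hinv.2.2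
    · exact Or.inl ⟨α, ⟨⟨hα, hfα, hneg⟩, fun hinv => hinv.2.2.not_gt hpos⟩, rfl⟩
  · rintro (⟨α, ⟨⟨hα, hpos, hneg⟩, hinv⟩, rfl⟩ | ⟨α, ⟨⟨hα, hpos, hneg⟩, hinv⟩, rfl⟩)
    · have hhα : h α ∈ X := (hh α).2 hα
      exact ⟨hhα, (hX0 _ hhα).lt_or_gt.resolve_left fun hlt => hinv ⟨hα, hpos, hlt⟩, hneg⟩
    · have hhα : h α ∈ X := (hh α).2 hα
      refine ⟨hX _ hhα, ?_, ?_⟩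
      · rwa [hf, Left.neg_pos_iff]
      · rw [map_neg, hf, Left.neg_neg_iff]
        exact (hX0 _ ((hg _).2 hhα)).lt_or_gt.resolve_left fun hlt => hinv ⟨hα, hpos, hlt⟩

theorem finite_inversions_mul (hf : f.Odd) (hX : ∀ α ∈ X, -α ∈ X) (hX0 : ∀ α ∈ X, f α ≠ 0)
    (hg : ∀ α, g α ∈ X ↔ α ∈ X) (hh : ∀ α, h α ∈ X ↔ α ∈ X)
    (hgfin : (inversions X f g).Finite) (hhfin : (inversions X f h).Finite) :
    (inversions X f (g * h)).Finite := by
  rw [inversions_eq_union hf hX hX0 hg hh] at hgfin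
  exact ((hgfin.subset Set.subset_union_left).of_finite_image h.injective.injOn).of_sdiff hhfin

theorem ncard_inversions_mul (hf : f.Odd) (hX : ∀ α ∈ X, -α ∈ X) (hX0 : ∀ α ∈ X, f α ≠ 0)
    (hg : ∀ α, g α ∈ X ↔ α ∈ X) (hh : ∀ α, h α ∈ X ↔ α ∈ X)
    (hgfin : (inversions X f g).Finite) (hhfin : (inversions X f h).Finite) :
    (inversions X f (g * h)).ncard + 2 * (inversions X f h \ inversions X f (g * h)).ncard =
      (inversions X f g).ncard + (inversions X f h).ncard := by
  have hghfin := finite_inversions_mul hf hX hX0 hg hh hgfin hhfin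
  have disj : Disjoint (h '' (inversions X f (g * h) \ inversions X f h))
      ((fun α => -h α) '' (inversions X f h \ inversions X f (g * h))) := by
    rw [Set.disjoint_left]
    rintro _ ⟨α, ⟨⟨-, hα, -⟩, -⟩, rfl⟩ ⟨β, ⟨⟨-, hβ, -⟩, -⟩, hβα⟩
    obtain rfl : -β = α := h.injective (by rw [map_neg]; exact hβα)
    rw [hf, Left.neg_pos_iff] at hα
    exact hα.not_gt hβ
  have neg_h_injective : Function.Injective fun α => -h α := neg_injective.comp h.injective
  have hg_card := congrArg Set.ncard (inversions_eq_union hf hX hX0 hg hh)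
  rw [Set.ncard_union_eq disj (hghfin.sdiff.image _) (hhfin.sdiff.image _),
    Set.ncard_image_of_injective _ h.injective,
    Set.ncard_image_of_injective _ neg_h_injective] at hg_card
  have hgh_card := Set.ncard_inter_add_ncard_sdiff_eq_ncard _ (inversions X f h) hghfin
  have hh_card := Set.ncard_inter_add_ncard_sdiff_eq_ncard _ (inversions X f (g * h)) hhfin
  rw [Set.inter_comm] at hh_card
  lia

/-- The automorphisms preserving `X` with an even number of inversions. Finiteness is demanded since
`ncard` of an infinite set is `0`. -/
def evenSubgroup (R : Type*) [Semiring R] [Module R M] (hf : f.Odd) (hX : ∀ α ∈ X, -α ∈ X)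
    (hX0 : ∀ α ∈ X, f α ≠ 0) : Subgroup (M ≃ₗ[R] M) where
  carrier := {g | (∀ α, g α ∈ X ↔ α ∈ X) ∧ (inversions X f g).Finite ∧
    Even (inversions X f g).ncard}
  one_mem' := by
    have hone : inversions X f (1 : M ≃ₗ[R] M) = ∅ :=
      Set.eq_empty_of_forall_notMem fun α hα => hα.2.1.not_gt hα.2.2
    exact ⟨fun _ => Iff.rfl, by simp [hone], by simp [hone]⟩
  mul_mem' := by
    rintro g h ⟨hg, hgfin, hgeven⟩ ⟨hh, hhfin, hheven⟩
    refine ⟨fun α => (hg _).trans (hh α), finite_inversions_mul hf hX hX0 hg hh hgfin hhfin, ?_⟩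
    have hcard := ncard_inversions_mul hf hX hX0 hg hh hgfin hhfin
    grind
  inv_mem' := by
    rintro g ⟨hg, hfin, heven⟩
    have neg_g_injective : Function.Injective fun α => -g α := neg_injective.comp g.injective
    rw [Set.mem_ofPred_eq, inversions_inv hf hX hg,
      Set.ncard_image_of_injective _ neg_g_injective]
    exact ⟨fun α => by rw [← hg, show g (g⁻¹ α) = α from g.apply_symm_apply α],
      hfin.image _, heven⟩

theorem even_ncard_inversions_sdiff (hf : f.Odd) (hX : ∀ α ∈ X, -α ∈ X)
    (hg : ∀ α, g α ∈ X ↔ α ∈ X) (hgg : ∀ α, g (g α) = α) (hfin : (inversions X f g).Finite) :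
    Even (inversions X f g \ {α | g α = -α}).ncard := by
  refine even_ncard_of_involution hfin.sdiff (σ := fun α => -g α) ?_ ?_ ?_
  · rintro α ⟨⟨hα, hpos, hneg⟩, hne⟩
    refine ⟨⟨hX _ ((hg α).2 hα), ?_, ?_⟩, fun heq => hne ?_⟩
    · rwa [hf, Left.neg_pos_iff]
    · rwa [map_neg, hgg, hf, Left.neg_neg_iff]
    · simpa [hgg] using heq.symm
  · intro α _
    simp only [map_neg, hgg, neg_neg]
  · rintro α ⟨-, hne⟩ heq
    exact hne (neg_eq_iff_eq_neg.1 heq)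

theorem mem_evenSubgroup_of_involution {hf : f.Odd} {hX : ∀ α ∈ X, -α ∈ X}
    {hX0 : ∀ α ∈ X, f α ≠ 0} (hg : ∀ α, g α ∈ X ↔ α ∈ X) (hgg : ∀ α, g (g α) = α)
    (hfin : (inversions X f g).Finite) (hne : ∀ α ∈ X, g α ≠ -α) :
    g ∈ evenSubgroup R hf hX hX0 := by
  refine ⟨hg, hfin, ?_⟩
  have hdisj : Disjoint (inversions X f g) {α | g α = -α} :=
    Set.disjoint_left.2 fun α hα => hne α hα.1
  rw [← hdisj.sdiff_eq_left]
  exact even_ncard_inversions_sdiff hf hX hg hgg hfin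

theorem notMem_evenSubgroup_of_involution {hf : f.Odd} {hX : ∀ α ∈ X, -α ∈ X}
    {hX0 : ∀ α ∈ X, f α ≠ 0} (hgg : ∀ α, g (g α) = α) {v : M} (hv : v ∈ X) (hgv : g v = -v)
    (huniq : ∀ α ∈ X, g α = -α → α = v ∨ α = -v) : g ∉ evenSubgroup R hf hX hX0 := by
  rintro ⟨hg, hfin, heven⟩
  wlog hpos : 0 < f v generalizing v
  · refine this (hX v hv) (by rw [map_neg, hgv]) (fun α hα hgα => ?_) ?_
    · rw [neg_neg]
      exact (huniq α hα hgα).symm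
    · rw [hf, Left.neg_pos_iff]
      exact (hX0 v hv).lt_or_gt.resolve_right hpos
  have hneg : inversions X f g ∩ {α | g α = -α} = {v} := by
    ext α
    constructor
    · rintro ⟨⟨hα, hα_pos, -⟩, hgα⟩
      refine (huniq α hα hgα).resolve_right ?_
      rintro rfl
      rw [hf, Left.neg_pos_iff] at hα_pos
      exact hα_pos.not_gt hpos
    · rintro rfl
      exact ⟨⟨hv, hpos, by rwa [hgv, hf, Left.neg_neg_iff]⟩, hgv⟩
  have hcard := Set.ncard_inter_add_ncard_sdiff_eq_ncard _ {α | g α = -α} hfin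
  have hrest := even_ncard_inversions_sdiff hf hX hg hgg hfin
  rw [hneg, Set.ncard_singleton] at hcard
  grind

end Inversions

/-! ### Mirrors separating two points of hyperbolic space -/

section FiniteDimensional

variable {E : Type*} [NormedAddCommGroup E] [NormedSpace ℝ E] [FiniteDimensional ℝ E]

theorem exists_pos_mul_sq_norm_le {B : LinearMap.BilinForm ℝ E} {K : Set E} (hK : IsCompact K)
    (h : ∀ z ∈ K, ∀ u, B u z = 0 → u ≠ 0 → 0 < B u u) :
    ∃ ε > 0, ∀ z ∈ K, ∀ u, B u z = 0 → ε * ‖u‖ ^ 2 ≤ B u u := by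
  have hB : Continuous fun p : E × E => B p.1 p.2 :=
    B.toContinuousBilinearMap.continuous₂
  have hcompact : IsCompact (Metric.sphere (0 : E) 1 ×ˢ K ∩ {p | B p.1 p.2 = 0}) :=
    ((isCompact_sphere 0 1).prod hK).inter_right (isClosed_eq hB continuous_const)
  obtain ⟨ε, hε, hle⟩ := hcompact.exists_forall_le' (f := fun p => B p.1 p.1)
    (hB.comp (continuous_fst.prodMk continuous_fst)).continuousOn (a := 0) fun p hp =>
      h p.2 hp.1.2 p.1 hp.2 (ne_zero_of_mem_unit_sphere ⟨p.1, hp.1.1⟩)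
  refine ⟨ε, hε, fun z hz u hu => ?_⟩
  rcases eq_or_ne u 0 with rfl | hu0
  · simp
  have hunit := hle (‖u‖⁻¹ • u, z) ⟨⟨by simp [norm_smul, hu0], hz⟩, by simp [hu]⟩
  simp only [map_smul, LinearMap.smul_apply, smul_eq_mul] at hunit
  calc ε * ‖u‖ ^ 2 ≤ (‖u‖⁻¹ * (‖u‖⁻¹ * B u u)) * ‖u‖ ^ 2 := by gcongr
    _ = B u u := by field_simp [norm_ne_zero_iff.2 hu0]

theorem exists_mem_forall_apply_ne_zero {ι : Type*} [Countable ι] {U : Set E} (hU : IsOpen U)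
    (hU' : U.Nonempty) {f : ι → E →ₗ[ℝ] ℝ} (hf : ∀ i, f i ≠ 0) : ∃ x ∈ U, ∀ i, f i x ≠ 0 := by
  borelize E
  by_contra! h
  have hnull : MeasureTheory.Measure.addHaar (⋃ i, (LinearMap.ker (f i) : Set E)) = 0 :=
    MeasureTheory.measure_iUnion_null fun i =>
      MeasureTheory.Measure.addHaar_submodule _ _ fun htop => hf i (LinearMap.ker_eq_top.1 htop)
  refine (hU.measure_pos MeasureTheory.Measure.addHaar hU').ne'
    (MeasureTheory.measure_mono_null (fun x hx => ?_) hnull)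
  exact Set.mem_iUnion.2 (h x hx)

end FiniteDimensional

namespace IsHyperbolic

variable {ι : Type*} [Fintype ι] [DecidableEq ι] {A : Matrix ι ι ℤ} {d : ι → ℝ}

theorem exists_realForm_neg_and_ne_zero (hA : IsHyperbolic A d) :
    ∃ x, realForm A d x x < 0 ∧ ∀ α ∈ realRoots A, realForm A d (toReal α) x ≠ 0 := by
  have hcont : Continuous fun x => realForm A d x x :=
    (realForm A d).toContinuousBilinearMap.continuous₂.comp (continuous_id.prodMk continuous_id)
  have hne (α : realRoots A) : realForm A d (toReal α) ≠ 0 := fun h =>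
    (hA.symmetrizer.form_pos_of_mem_realRoots hA.gcm α.2).ne'
      (by rw [form_eq_realForm, h, LinearMap.zero_apply])
  obtain ⟨x, hx, hαx⟩ := exists_mem_forall_apply_ne_zero
    (isOpen_lt hcont continuous_const) hA.exists_realForm_neg hne
  exact ⟨x, hx, fun α hα => hαx ⟨α, hα⟩⟩

theorem finite_setOf_realRoots_separating (hA : IsHyperbolic A d) {x y : ι → ℝ}
    (hxy : ∀ z ∈ segment ℝ x y, realForm A d z z < 0) :
    {α ∈ realRoots A | 0 < realForm A d (toReal α) x ∧ realForm A d (toReal α) y < 0}.Finite := by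
  have hK : IsCompact (segment ℝ x y) := by
    rw [← convexHull_pair]
    exact (Set.toFinite {x, y}).isCompact_convexHull (𝕜 := ℝ)
  obtain ⟨ε, hε, hle⟩ := exists_pos_mul_sq_norm_le hK fun z hz u hu hu0 =>
    hA.realForm_pos_of_orthogonal (hxy z hz) hu hu0
  refine (isCompact_closedBall (0 : ι → ℤ) √((∑ i, 2 * d i) / ε)).finite_of_discrete.subset ?_
  rintro α ⟨hα, hαx, hαy⟩
  have hd (i : ι) : 0 ≤ 2 * d i := by linarith [hA.symmetrizer.pos i]
  obtain ⟨z, hz, hαz⟩ : ∃ z ∈ segment ℝ x y, realForm A d (toReal α) z = 0 := by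
    have hmem : (0 : ℝ) ∈ realForm A d (toReal α) '' segment ℝ x y := by
      rw [← LinearMap.coe_toAffineMap, image_segment, segment_symm, LinearMap.coe_toAffineMap,
        segment_eq_Icc (hαy.trans hαx).le]
      exact ⟨hαy.le, hαx.le⟩
    exact hmem
  have hsq : ε * ‖α‖ ^ 2 ≤ ∑ i, 2 * d i := by
    obtain ⟨i, hi⟩ := hA.symmetrizer.exists_form_eq_of_mem_realRoots hA.gcm hα
    calc ε * ‖α‖ ^ 2 ≤ form A d α α := by
          rw [form_eq_realForm]
          exact hle z hz (toReal α) hαz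
      _ = 2 * d i := hi
      _ ≤ ∑ i, 2 * d i := Finset.single_le_sum (fun i _ => hd i) (Finset.mem_univ i)
  rw [mem_closedBall_zero_iff]
  exact Real.le_sqrt_of_sq_le ((le_div_iff₀' hε).2 hsq)

theorem finite_inversions_realRoots (hA : IsHyperbolic A d) {x : ι → ℝ}
    (hx : realForm A d x x < 0) {r : ι → ℤ} {s : (ι → ℤ) ≃ₗ[ℤ] (ι → ℤ)}
    (hs : IsReflectionIn A d r s) :
    (inversions (realRoots A) (fun α => realForm A d (toReal α) x) s).Finite := by
  set ρ := toReal r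
  have hρ : 0 < realForm A d ρ ρ := (form_eq_realForm A d r r) ▸ hs.1
  set c := 2 * realForm A d ρ x / realForm A d ρ ρ with hc
  have hneg : ∀ z ∈ segment ℝ x (x + (-c) • ρ), realForm A d z z < 0 := by
    rw [segment_eq_image']
    rintro _ ⟨t, ⟨ht0, ht1⟩, rfl⟩
    have hcρ : c * realForm A d ρ ρ = 2 * realForm A d ρ x := div_mul_cancel₀ _ hρ.ne'
    have hexpand := bilinForm_add_smul_self hA.symmetrizer.isSymm_realForm x ρ (t * -c)
    rw [hA.symmetrizer.realForm_comm x ρ] at hexpand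
    beta_reduce
    rw [add_sub_cancel_left, smul_smul, hexpand]
    have : 0 ≤ t * (1 - t) * (c ^ 2 * realForm A d ρ ρ) := by
      have := sub_nonneg.2 ht1
      positivity
    linear_combination hx + this + t * c * hcρ
  have hinv (α : ι → ℤ) :
      realForm A d (toReal (s α)) x = realForm A d (toReal α) (x + (-c) • ρ) := by
    rw [hs.toReal_eq]
    simp only [map_add, map_sub, map_smul, LinearMap.sub_apply, LinearMap.smul_apply, smul_eq_mul,
      form_eq_realForm, hc, ρ]
    ring
  exact (hA.finite_setOf_realRoots_separating hneg).subset fun α ⟨hα, hpos, hneg⟩ =>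
    ⟨hα, hpos, (hinv α).symm.trans_lt hneg⟩

end IsHyperbolic

/-! ### Reflections in the group of a reflection-stable set of roots -/

/-- `R` is stable under the reflections in its elements, as the set of real roots of a root
subsystem is. -/
def IsReflectionStable {ι : Type*} [Fintype ι] (A : Matrix ι ι ℤ) (d : ι → ℝ)
    (R : Set (ι → ℤ)) : Prop :=
  ∀ r ∈ R, ∀ s, IsReflectionIn A d r s → ∀ t ∈ R, s t ∈ R

section Stable

variable {ι : Type*} [Fintype ι] [DecidableEq ι] {A : Matrix ι ι ℤ} {d : ι → ℝ}
  {R : Set (ι → ℤ)} {s : (ι → ℤ) ≃ₗ[ℤ] (ι → ℤ)}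

theorem IsSymmetrizer.reflectionGroup_le_weylGroup (hd : IsSymmetrizer A d) (hA : IsGCM A)
    (hR : R ⊆ realRoots A) : reflectionGroup A d R ≤ weylGroup A :=
  (Subgroup.closure_le _).2 fun _ ⟨_, hv, hs⟩ => hd.reflection_mem_weylGroup hA (hR hv) hs

namespace IsReflectionStable

theorem neg_mem (hstab : IsReflectionStable A d R) (hd : IsSymmetrizer A d) (hA : IsGCM A)
    (hR : R ⊆ realRoots A) {r : ι → ℤ} (hr : r ∈ R) : -r ∈ R := by
  obtain ⟨s, -, hs⟩ := hd.exists_isReflectionIn hA (hR hr)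
  rw [← hs.apply_self]
  exact hstab r hr s hs r hr

theorem map_mem_sdiff_iff (hstab : IsReflectionStable A d R) (hd : IsSymmetrizer A d)
    (hA : IsGCM A) (hR : R ⊆ realRoots A) {r : ι → ℤ} (hr : r ∈ R)
    (hs : IsReflectionIn A d r s) (α : ι → ℤ) :
    s α ∈ realRoots A \ R ↔ α ∈ realRoots A \ R := by
  have hsW := hd.reflection_mem_weylGroup hA (hR hr) hs
  have of_mem (β : ι → ℤ) (hβ : β ∈ realRoots A \ R) : s β ∈ realRoots A \ R :=
    ⟨map_mem_realRoots hsW hβ.1,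
      fun h => hβ.2 (by simpa [hs.apply_apply hd] using hstab r hr s hs _ h)⟩
  exact ⟨fun h => by simpa [hs.apply_apply hd] using of_mem _ h, of_mem α⟩

theorem mem_of_reflection_mem (hstab : IsReflectionStable A d R) (hA : IsHyperbolic A d)
    (hR : R ⊆ realRoots A) {v : ι → ℤ} (hv : v ∈ realRoots A) (hs : IsReflectionIn A d v s)
    (hmem : s ∈ reflectionGroup A d R) : v ∈ R := by
  by_contra hvR
  have hvX : v ∈ realRoots A \ R := ⟨hv, hvR⟩
  have hd := hA.symmetrizer
  have neg_mem_R {r} (hr : r ∈ R) : -r ∈ R := hstab.neg_mem hd hA.gcm hR hr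
  obtain ⟨x, hx, hgen⟩ := hA.exists_realForm_neg_and_ne_zero
  let f : (ι → ℤ) → ℝ := fun α => realForm A d (toReal α) x
  have hf : f.Odd := fun α => by simp only [f, map_neg, LinearMap.neg_apply]
  have hX : ∀ α ∈ realRoots A \ R, -α ∈ realRoots A \ R := fun α hα =>
    ⟨hd.neg_mem_realRoots hA.gcm hα.1, fun h => hα.2 (neg_neg α ▸ neg_mem_R h)⟩
  have hX0 : ∀ α ∈ realRoots A \ R, f α ≠ 0 := fun α hα => hgen α hα.1
  have hle : reflectionGroup A d R ≤ evenSubgroup ℤ hf hX hX0 := by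
    refine (Subgroup.closure_le _).2 ?_
    rintro t ⟨r, hr, ht⟩
    have hfin : (inversions (realRoots A \ R) f t).Finite :=
      (hA.finite_inversions_realRoots hx ht).subset fun α hα => ⟨hα.1.1, hα.2⟩
    refine mem_evenSubgroup_of_involution (hstab.map_mem_sdiff_iff hd hA.gcm hR hr ht)
      (ht.apply_apply hd) hfin fun α hα htα => ?_
    rcases hd.eq_or_eq_neg_of_reflection hA.gcm hα.1 (hR hr) ht htα with rfl | rfl
    exacts [hα.2 hr, hα.2 (neg_mem_R hr)]
  exact notMem_evenSubgroup_of_involution (hs.apply_apply hd) hvX hs.apply_self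
    (fun α hα hsα => hd.eq_or_eq_neg_of_reflection hA.gcm hα.1 hv hs hsα) (hle hmem)

end IsReflectionStable

end Stable

/-! ### Descent on vectors of the root lattice -/

section Size

variable {ι : Type*}

theorem sub_zsmul_simpleRoot_apply_self [DecidableEq ι] (x : ι → ℤ) (m : ℤ) (i : ι) :
    (x - m • simpleRoot i) i = x i - m := by simp [simpleRoot]

theorem sub_zsmul_simpleRoot_apply_of_ne [DecidableEq ι] (x : ι → ℤ) (m : ℤ) {i j : ι}
    (h : j ≠ i) : (x - m • simpleRoot i) j = x j := by simp [simpleRoot, h]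

variable [Fintype ι]

/-- The sum of the absolute values of the coordinates, the measure of the descent. -/
def size (x : ι → ℤ) : ℕ := ∑ i, (x i).natAbs

theorem size_neg (x : ι → ℤ) : size (-x) = size x := by
  simp only [size, Pi.neg_apply, Int.natAbs_neg]

theorem size_eq_of_eq_or_eq_neg {x y : ι → ℤ} (h : y = x ∨ y = -x) : size y = size x := by
  rcases h with rfl | rfl
  exacts [rfl, size_neg x]

theorem size_sub_zsmul_simpleRoot_lt [DecidableEq ι] {x : ι → ℤ} {m : ℤ} {i : ι} (hm : 0 < m)
    (hm' : m < 2 * x i) : size (x - m • simpleRoot i) < size x := by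
  refine Finset.sum_lt_sum (fun j _ => ?_) ⟨i, Finset.mem_univ _, ?_⟩
  · rcases eq_or_ne j i with rfl | h
    · rw [sub_zsmul_simpleRoot_apply_self]
      lia
    · rw [sub_zsmul_simpleRoot_apply_of_ne _ _ h]
  · rw [sub_zsmul_simpleRoot_apply_self]
    lia

end Size

section Descent

variable {ι : Type*} [Fintype ι] [DecidableEq ι] {A : Matrix ι ι ℤ} {d : ι → ℝ}

theorem IsSymmetrizer.exists_apply_mul_form_pos (hd : IsSymmetrizer A d) {x : ι → ℤ}
    (hx : 0 < form A d x x) : ∃ i, 0 < (x i : ℝ) * form A d x (simpleRoot i) := by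
  by_contra! h
  refine hx.not_ge ((form_eq_sum A d x x).trans_le (Finset.sum_nonpos fun i _ => ?_))
  rw [hd.form_comm]
  exact h i

/-- A set of vectors of positive square, stable under negation and simple reflections, which
contains no simple root, such that `α - α_i` is in the set if `α` is, `(α | α_i) > 0` and not both
Cartan integers of `α` and `α_i` exceed `1`. The real roots outside a closed root subsystem with the
same lattice form such a set. -/
structure IsDescentSet (A : Matrix ι ι ℤ) (d : ι → ℝ) (X : Set (ι → ℤ)) : Prop where
  neg_mem : ∀ α ∈ X, -α ∈ X
  form_pos : ∀ α ∈ X, 0 < form A d α α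
  simpleRoot_notMem : ∀ i, simpleRoot i ∉ X
  sub_mem : ∀ α ∈ X, ∀ i, 0 < form A d α (simpleRoot i) → α - simpleRoot i ∈ X ∨
    (form A d α α ≤ form A d α (simpleRoot i) ∧
      form A d (simpleRoot i) (simpleRoot i) ≤ form A d α (simpleRoot i))
  reflection_mem : ∀ α ∈ X, ∀ i, ∃ m : ℤ, 2 * form A d α (simpleRoot i) =
    m * form A d (simpleRoot i) (simpleRoot i) ∧ α - m • simpleRoot i ∈ X

namespace IsDescentSet

variable {X : Set (ι → ℤ)}

theorem exists_apply_pos_and_form_pos (hX : IsDescentSet A d X) (hd : IsSymmetrizer A d)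
    {α : ι → ℤ} (hα : α ∈ X) :
    ∃ β ∈ X, (β = α ∨ β = -α) ∧ ∃ i, 0 < β i ∧ 0 < form A d β (simpleRoot i) := by
  obtain ⟨i, hi⟩ := hd.exists_apply_mul_form_pos (hX.form_pos α hα)
  rcases mul_pos_iff.1 hi with ⟨hi, hf⟩ | ⟨hi, hf⟩
  · exact ⟨α, hα, .inl rfl, i, by exact_mod_cast hi, hf⟩
  · refine ⟨-α, hX.neg_mem α hα, .inr rfl, i, neg_pos.2 (by exact_mod_cast hi), ?_⟩
    rwa [form_neg_left, neg_pos]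

theorem apply_sub_two_nonneg (hX : IsDescentSet A d X) (hA : IsHyperbolic A d) {α : ι → ℤ}
    (hα : α ∈ X) {i : ι} (hi : 0 < α i)
    (hsq : form A d (α - simpleRoot i) (α - simpleRoot i) = 0)
    (hort : form A d (simpleRoot i) (α - simpleRoot i) = 0) : 0 ≤ α i - 2 := by
  by_contra! hlt
  rw [form_eq_realForm] at hsq hort
  rw [toReal_simpleRoot] at hort
  have hzero : α - simpleRoot i = 0 := by
    refine toReal_injective ((hA.eq_zero_of_realForm_single_eq_zero (l := i) ?_ hsq.le hort).trans
      (map_zero _).symm)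
    rw [toReal_apply, Int.cast_eq_zero, Pi.sub_apply, simpleRoot, Pi.single_eq_same]
    lia
  exact hX.simpleRoot_notMem i (sub_eq_zero.1 hzero ▸ hα)

-- If `α - α_i` is not in the set, its square is nonpositive although it has coordinates of both
-- signs, so it is isotropic and orthogonal to `α_i`, and reflection turns `α` into `α - 2 α_i`.
theorem exists_size_lt_of_mixed (hX : IsDescentSet A d X) (hA : IsHyperbolic A d) {α : ι → ℤ}
    (hα : α ∈ X) {i j : ι} (hi : 0 < α i) (hpos : 0 < form A d α (simpleRoot i)) (hj : α j ≤ 0) :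
    ∃ β ∈ X, size β < size α ∧ 0 ≤ β i ∧ β j ≤ 0 := by
  have hji : j ≠ i := by
    rintro rfl
    exact hj.not_gt hi
  suffices h : ∃ m : ℤ, 0 < m ∧ 0 ≤ α i - m ∧ α - m • simpleRoot i ∈ X by
    obtain ⟨m, hm, him, hmem⟩ := h
    refine ⟨_, hmem, size_sub_zsmul_simpleRoot_lt hm (by lia), ?_, ?_⟩
    · rwa [sub_zsmul_simpleRoot_apply_self]
    · rwa [sub_zsmul_simpleRoot_apply_of_ne _ _ hji]
  rcases hX.sub_mem α hα i hpos with hmem | ⟨hα_le, hi_le⟩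
  · exact ⟨1, one_pos, by lia, by rwa [one_smul]⟩
  have hsq : 0 ≤ form A d (α - simpleRoot i) (α - simpleRoot i) := by
    rw [form_eq_realForm]
    refine hA.realForm_nonneg_of_mixed (i := i) (j := j) ?_ ?_ <;>
      simp only [toReal_apply, Pi.sub_apply, simpleRoot, Pi.single_eq_same,
        Pi.single_eq_of_ne hji] <;> norm_cast <;> lia
  have hexpand := hA.symmetrizer.form_sub_self α (simpleRoot i)
  have hii : form A d (simpleRoot i) (simpleRoot i) = form A d α (simpleRoot i) := by linarith
  obtain ⟨m, hm, hmem⟩ := hX.reflection_mem α hα i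
  have hm2 : m = 2 := by
    rw [hii] at hm
    exact_mod_cast (mul_right_cancel₀ hpos.ne' hm).symm
  refine ⟨2, two_pos, hX.apply_sub_two_nonneg hA hα hi (by linarith) ?_, hm2 ▸ hmem⟩
  rw [hA.symmetrizer.form_comm, form_sub_left, hii, sub_self]

theorem forall_pos_or_forall_neg (hX : IsDescentSet A d X) (hA : IsHyperbolic A d) {α : ι → ℤ}
    (hα : α ∈ X) : (∀ i, 0 < α i) ∨ ∀ i, α i < 0 := by
  induction hn : size α using Nat.strong_induction_on generalizing α with
  | _ n ih =>
  subst hn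
  obtain ⟨β, hβ, hβα, i, hi, hpos⟩ := hX.exists_apply_pos_and_form_pos hA.symmetrizer hα
  have hsize : size β = size α := size_eq_of_eq_or_eq_neg hβα
  have hβpos : ∀ j, 0 < β j := by
    by_contra! ⟨j, hj⟩
    obtain ⟨γ, hγ, hlt, hγi, hγj⟩ := hX.exists_size_lt_of_mixed hA hβ hi hpos hj
    exact (ih _ (hsize ▸ hlt) hγ rfl).elim (fun h => (h j).not_ge hγj) fun h => (h i).not_ge hγi
  rcases hβα with rfl | rfl
  exacts [.inl hβpos, .inr fun j => neg_pos.1 (hβpos j)]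

theorem eq_empty (hX : IsDescentSet A d X) (hA : IsHyperbolic A d) : X = ∅ := by
  refine Set.eq_empty_iff_forall_notMem.2 fun α hα => ?_
  induction hn : size α using Nat.strong_induction_on generalizing α with
  | _ n ih =>
  subst hn
  obtain ⟨β, hβ, hβα, i, hi, hpos⟩ := hX.exists_apply_pos_and_form_pos hA.symmetrizer hα
  have hsize : size β = size α := size_eq_of_eq_or_eq_neg hβα
  obtain ⟨m, hm, hmem⟩ := hX.reflection_mem β hβ i
  have hm0 : 0 < m := by
    have hdi := hA.symmetrizer.pos i
    rw [hA.gcm.form_simpleRoot_self] at hm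
    exact_mod_cast pos_of_mul_pos_left (hm ▸ mul_pos two_pos hpos) (by positivity)
  obtain ⟨j, hj⟩ := hA.exists_ne i
  have hβj : 0 < β j := (hX.forall_pos_or_forall_neg hA hβ).elim (· j) fun h =>
    absurd hi (h i).not_gt
  have hγi : 0 < (β - m • simpleRoot i) i :=
    (hX.forall_pos_or_forall_neg hA hmem).elim (· i) fun h =>
      absurd hβj (sub_zsmul_simpleRoot_apply_of_ne β m hj ▸ h j).not_gt
  rw [sub_zsmul_simpleRoot_apply_self] at hγi
  exact ih _ (hsize ▸ size_sub_zsmul_simpleRoot_lt hm0 (by lia)) _ hmem rfl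

end IsDescentSet

end Descent

/-! ### Maximal rank root subsystems -/

section Ambient

variable {ι : Type*} [Fintype ι] {A : Matrix ι ι ℤ} {d : ι → ℝ}

theorem ClosedIn.inter {M S : Type*} [Add M] [SetLike S M] [AddMemClass S M] (Δ : Set M) (N : S) :
    ClosedIn (Δ ∩ N) Δ :=
  fun _ hα _ hβ hαβ => ⟨hαβ, add_mem hα.2 hβ.2⟩

theorem isReflectionGroup_reflectionGroup (A : Matrix ι ι ℤ) (d : ι → ℝ) (S : Set (ι → ℤ)) :
    IsReflectionGroup A d (reflectionGroup A d S) :=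
  ⟨{w | ∃ v ∈ S, IsReflectionIn A d v w}, fun _ ⟨v, _, hw⟩ => ⟨v, hw⟩, rfl⟩

theorem reflectionGroup_mono {S T : Set (ι → ℤ)} (hST : S ⊆ T) :
    reflectionGroup A d S ≤ reflectionGroup A d T := by
  refine Subgroup.closure_mono ?_
  rintro w ⟨v, hv, hw⟩
  exact ⟨v, hST hv, hw⟩

theorem reflection_mem_reflectionGroup {S : Set (ι → ℤ)} {v : ι → ℤ} (hv : v ∈ S)
    {s : (ι → ℤ) ≃ₗ[ℤ] (ι → ℤ)} (hs : IsReflectionIn A d v s) : s ∈ reflectionGroup A d S :=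
  Subgroup.subset_closure ⟨v, hv, hs⟩

variable [DecidableEq ι]

theorem IsReflectionStable.realRoots_inter (hd : IsSymmetrizer A d) (hA : IsGCM A)
    (N : Submodule ℤ (ι → ℤ)) : IsReflectionStable A d (realRoots A ∩ N) := by
  rintro r hr s hs t ht
  refine ⟨map_mem_realRoots (hd.reflection_mem_weylGroup hA hr.1 hs) ht.1, ?_⟩
  obtain ⟨m, hm⟩ := hd.exists_pairing hA hr.1 t
  rw [hs.apply_eq hm]
  exact sub_mem ht.2 (N.smul_mem _ hr.2)

theorem IsHyperbolic.reflectionGroup_realRoots_inter_lt (hA : IsHyperbolic A d)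
    {N : Submodule ℤ (ι → ℤ)} (hN : N < ⊤) :
    reflectionGroup A d (realRoots A ∩ N) < weylGroup A := by
  have hd := hA.symmetrizer
  refine (hd.reflectionGroup_le_weylGroup hA.gcm Set.inter_subset_left).lt_of_ne fun heq => ?_
  have hsimple (i : ι) : simpleRoot i ∈ realRoots A ∩ N :=
    (IsReflectionStable.realRoots_inter hd hA.gcm N).mem_of_reflection_mem hA
      Set.inter_subset_left (simpleRoot_mem_realRoots A i)
      (hd.isReflectionIn_simpleRoot hA.gcm fun _ => rfl)
      (heq ▸ simpleReflection_mem_weylGroup hA.gcm i)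
  refine hN.ne (eq_top_iff.2 fun x _ => ?_)
  rw [pi_eq_sum_univ' x]
  exact sum_mem fun i _ => N.smul_mem _ (hsimple i).2

theorem IsSymmetrizer.sub_mem_realRoots_or (hd : IsSymmetrizer A d) (hA : IsGCM A) {u v : ι → ℤ}
    (hu : u ∈ realRoots A) (hv : v ∈ realRoots A) (hpos : 0 < form A d u v) :
    u - v ∈ realRoots A ∨ (form A d u u ≤ form A d u v ∧ form A d v v ≤ form A d u v) := by
  obtain ⟨m, hm⟩ := hd.exists_pairing hA hv u
  obtain ⟨n, hn⟩ := hd.exists_pairing hA hu v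
  have huu := hd.form_pos_of_mem_realRoots hA hu
  have hvv := hd.form_pos_of_mem_realRoots hA hv
  have hm0 : 0 < m := by exact_mod_cast pos_of_mul_pos_left (hm ▸ mul_pos two_pos hpos) hvv.le
  have hn0 : 0 < n := by
    rw [hd.form_comm] at hn
    exact_mod_cast pos_of_mul_pos_left (hn ▸ mul_pos two_pos hpos) huu.le
  rcases (show m = 1 ∨ 2 ≤ m by lia) with rfl | hm2
  · exact .inl (by simpa using hd.sub_zsmul_mem_realRoots hA hv hu hm)
  rcases (show n = 1 ∨ 2 ≤ n by lia) with rfl | hn2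
  · exact .inl (by
      simpa using hd.neg_mem_realRoots hA (hd.sub_zsmul_mem_realRoots hA hu hv hn))
  · have hm2' : (2 : ℝ) ≤ m := by exact_mod_cast hm2
    have hn2' : (2 : ℝ) ≤ n := by exact_mod_cast hn2
    rw [hd.form_comm v u] at hn
    right
    constructor <;> nlinarith

end Ambient

namespace IsRootSystemIn

variable {ι κ : Type*} [Fintype ι] [DecidableEq ι] [Fintype κ] [DecidableEq κ]
  {A : Matrix ι ι ℤ} {d : ι → ℝ} {A₁ : Matrix κ κ ℤ} {d₁ : κ → ℝ}
  {φ : (κ → ℤ) →ₗ[ℤ] (ι → ℤ)}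

omit [Fintype ι] [DecidableEq ι] in
theorem range_simpleRoot_subset (A₁ : Matrix κ κ ℤ) (φ : (κ → ℤ) →ₗ[ℤ] (ι → ℤ)) :
    (Set.range fun j => φ (simpleRoot j)) ⊆ φ '' realRoots A₁ :=
  Set.range_subset_iff.2 fun j => ⟨_, simpleRoot_mem_realRoots A₁ j, rfl⟩

theorem form_pos_iff (hφ : IsRootSystemIn A d A₁ d₁ φ) (x y : κ → ℤ) :
    0 < form A d (φ x) (φ y) ↔ 0 < form A₁ d₁ x y := by
  obtain ⟨c, hc, hform⟩ := hφ.form_eq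
  rw [hform, mul_pos_iff_of_pos_left hc]

theorem form_le_iff (hφ : IsRootSystemIn A d A₁ d₁ φ) (x y z w : κ → ℤ) :
    form A d (φ x) (φ y) ≤ form A d (φ z) (φ w) ↔ form A₁ d₁ x y ≤ form A₁ d₁ z w := by
  obtain ⟨c, hc, hform⟩ := hφ.form_eq
  rw [hform, hform, mul_le_mul_iff_right₀ hc]

theorem pairing_eq (hφ : IsRootSystemIn A d A₁ d₁ φ) {x y : κ → ℤ} {m : ℤ}
    (h : 2 * form A₁ d₁ x y = m * form A₁ d₁ y y) :
    2 * form A d (φ x) (φ y) = m * form A d (φ y) (φ y) := by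
  obtain ⟨c, -, hform⟩ := hφ.form_eq
  rw [hform, hform]
  linear_combination c * h

theorem reflection_apply_map (hφ : IsRootSystemIn A d A₁ d₁ φ) {ρ x : κ → ℤ} {m : ℤ}
    (h : 2 * form A₁ d₁ x ρ = m * form A₁ d₁ ρ ρ) {s : (ι → ℤ) ≃ₗ[ℤ] (ι → ℤ)}
    (hs : IsReflectionIn A d (φ ρ) s) : s (φ x) = φ (x - m • ρ) := by
  rw [hs.apply_eq (hφ.pairing_eq h), map_sub, map_smul]

theorem map_mem_imagRoots_iff (hφ : IsRootSystemIn A d A₁ d₁ φ) {x : κ → ℤ} :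
    φ x ∈ imagRoots A d ↔ x ∈ imagRoots A₁ d₁ := by
  rw [imagRoots, imagRoots, Set.mem_ofPred_eq, Set.mem_ofPred_eq,
    map_ne_zero_iff φ hφ.injective, ← not_lt, ← not_lt, hφ.form_pos_iff]

theorem closedIn_realRoots (hφ : IsRootSystemIn A d A₁ d₁ φ) (hd : IsSymmetrizer A d)
    (hA : IsGCM A) (hclosed : ClosedIn (φ '' roots A₁ d₁) (roots A d)) :
    ClosedIn (φ '' realRoots A₁) (realRoots A) := by
  intro α hα β hβ hαβ
  obtain ⟨x, hx | hx, hxαβ⟩ := hclosed α (Set.image_mono Set.subset_union_left hα) β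
    (Set.image_mono Set.subset_union_left hβ) (.inl hαβ)
  · exact ⟨x, hx, hxαβ⟩
  · rw [← hxαβ] at hαβ
    exact absurd (hφ.map_mem_imagRoots_iff.2 hx).2 (hd.form_pos_of_mem_realRoots hA hαβ).not_ge

section Symmetrizable

variable (hφ : IsRootSystemIn A d A₁ d₁ φ) (hd₁ : IsSymmetrizer A₁ d₁) (hA₁ : IsGCM A₁)

include hφ hd₁ hA₁

theorem image_realRoots_subset : φ '' realRoots A₁ ⊆ realRoots A := by
  rintro _ ⟨x, hx, rfl⟩
  refine (hφ.subset ⟨x, .inl hx, rfl⟩).resolve_right fun h => h.2.not_gt ?_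
  exact (hφ.form_pos_iff x x).2 (hd₁.form_pos_of_mem_realRoots hA₁ hx)

theorem isReflectionStable : IsReflectionStable A d (φ '' realRoots A₁) := by
  rintro _ ⟨ρ, hρ, rfl⟩ s hs _ ⟨x, hx, rfl⟩
  obtain ⟨m, hm⟩ := hd₁.exists_pairing hA₁ hρ x
  exact ⟨_, hd₁.sub_zsmul_mem_realRoots hA₁ hρ hx hm, (hφ.reflection_apply_map hm hs).symm⟩

theorem subWeylGroup_le (hd : IsSymmetrizer A d) (hA : IsGCM A) :
    subWeylGroup A d φ ≤ weylGroup A :=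
  hd.reflectionGroup_le_weylGroup hA
    ((range_simpleRoot_subset A₁ φ).trans (hφ.image_realRoots_subset hd₁ hA₁))

theorem exists_mem_subWeylGroup (hd : IsSymmetrizer A d) (hA : IsGCM A)
    {w : (κ → ℤ) ≃ₗ[ℤ] (κ → ℤ)} (hw : w ∈ weylGroup A₁) :
    ∃ g ∈ subWeylGroup A d φ, ∀ x, g (φ x) = φ (w x) := by
  induction hw using Subgroup.closure_induction with
  | mem w hw =>
    obtain ⟨j, hj⟩ := hw
    have hroot := simpleRoot_mem_realRoots A₁ j
    obtain ⟨s, -, hs⟩ :=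
      hd.exists_isReflectionIn hA (hφ.image_realRoots_subset hd₁ hA₁ ⟨_, hroot, rfl⟩)
    refine ⟨s, reflection_mem_reflectionGroup (Set.mem_range_self j) hs, fun x => ?_⟩
    obtain ⟨m, hm⟩ := hd₁.exists_pairing hA₁ hroot x
    rw [hφ.reflection_apply_map hm hs, (hd₁.isReflectionIn_simpleRoot hA₁ hj).apply_eq hm]
  | one => exact ⟨1, one_mem _, fun _ => rfl⟩
  | mul w₁ w₂ _ _ ih₁ ih₂ =>
    obtain ⟨g₁, hg₁, h₁⟩ := ih₁
    obtain ⟨g₂, hg₂, h₂⟩ := ih₂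
    refine ⟨g₁ * g₂, mul_mem hg₁ hg₂, fun x => ?_⟩
    rw [LinearEquiv.mul_apply, h₂, h₁, LinearEquiv.mul_apply]
  | inv w _ ih =>
    obtain ⟨g, hg, h⟩ := ih
    refine ⟨g⁻¹, inv_mem hg, fun x => g.injective ?_⟩
    rw [h, ← LinearEquiv.mul_apply, ← LinearEquiv.mul_apply, mul_inv_cancel, mul_inv_cancel]
    rfl

theorem reflection_mem_subWeylGroup (hd : IsSymmetrizer A d) (hA : IsGCM A) {x : κ → ℤ}
    (hx : x ∈ realRoots A₁) {s : (ι → ℤ) ≃ₗ[ℤ] (ι → ℤ)} (hs : IsReflectionIn A d (φ x) s) :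
    s ∈ subWeylGroup A d φ := by
  obtain ⟨w, hw, j, rfl⟩ := hx
  obtain ⟨g, hg, hgφ⟩ := hφ.exists_mem_subWeylGroup hd₁ hA₁ hd hA hw
  obtain ⟨t, -, ht⟩ := hd.exists_isReflectionIn hA
    (hφ.image_realRoots_subset hd₁ hA₁ ⟨_, simpleRoot_mem_realRoots A₁ j, rfl⟩)
  have hgform := fun x y => hd.form_map_of_mem_weylGroup hA
    (hφ.subWeylGroup_le hd₁ hA₁ hd hA hg) x y
  rw [← hgφ] at hs
  rw [hs.unique (ht.conj hgform)]
  exact mul_mem (mul_mem hg (reflection_mem_reflectionGroup (Set.mem_range_self j) ht)) (inv_mem hg)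

theorem isDescentSet (hd : IsSymmetrizer A d) (hA : IsGCM A)
    (hclosed : ClosedIn (φ '' realRoots A₁) (realRoots A)) :
    IsDescentSet A₁ d₁ (φ ⁻¹' realRoots A \ realRoots A₁) where
  neg_mem α hα := by
    refine ⟨?_, fun h => hα.2 (by simpa using hd₁.neg_mem_realRoots hA₁ h)⟩
    rw [Set.mem_preimage, map_neg]
    exact hd.neg_mem_realRoots hA hα.1
  form_pos α hα := (hφ.form_pos_iff α α).1 (hd.form_pos_of_mem_realRoots hA hα.1)
  simpleRoot_notMem i h := h.2 (simpleRoot_mem_realRoots A₁ i)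
  reflection_mem α hα i := by
    have hroot := simpleRoot_mem_realRoots A₁ i
    obtain ⟨m, hm⟩ := hd₁.exists_pairing hA₁ hroot α
    refine ⟨m, hm, ?_, fun h => hα.2 ?_⟩
    · rw [Set.mem_preimage, map_sub, map_smul]
      exact hd.sub_zsmul_mem_realRoots hA
        (hφ.image_realRoots_subset hd₁ hA₁ ⟨_, hroot, rfl⟩) hα.1 (hφ.pairing_eq hm)
    · have hm' : 2 * form A₁ d₁ (α - m • simpleRoot i) (simpleRoot i) =
          (-m : ℤ) * form A₁ d₁ (simpleRoot i) (simpleRoot i) := by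
        rw [form_sub_left, form_zsmul_left, Int.cast_neg]
        linear_combination hm
      simpa using hd₁.sub_zsmul_mem_realRoots hA₁ hroot h hm'
  sub_mem α hα i hpos := by
    have hroot := simpleRoot_mem_realRoots A₁ i
    rw [← hφ.form_pos_iff] at hpos
    simp only [← hφ.form_le_iff]
    refine (hd.sub_mem_realRoots_or hA hα.1
      (hφ.image_realRoots_subset hd₁ hA₁ ⟨_, hroot, rfl⟩) hpos).imp_left fun hsub => ?_
    rw [← map_sub] at hsub
    refine ⟨hsub, fun h => hα.2 ?_⟩
    rw [← hφ.injective.mem_set_image, ← sub_add_cancel α (simpleRoot i), map_add]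
    refine hclosed _ ⟨_, h, rfl⟩ _ ⟨_, hroot, rfl⟩ ?_
    rw [← map_add, sub_add_cancel]
    exact hα.1

end Symmetrizable

theorem preimage_realRoots_subset (hφ : IsRootSystemIn A d A₁ d₁ φ) (hA₁ : IsHyperbolic A₁ d₁)
    (hd : IsSymmetrizer A d) (hA : IsGCM A)
    (hclosed : ClosedIn (φ '' realRoots A₁) (realRoots A)) :
    φ ⁻¹' realRoots A ⊆ realRoots A₁ :=
  Set.sdiff_eq_empty.1 ((hφ.isDescentSet hA₁.symmetrizer hA₁.gcm hd hA hclosed).eq_empty hA₁)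

theorem weylGroup_le_subWeylGroup (hφ : IsRootSystemIn A d A₁ d₁ φ) (hA₁ : IsHyperbolic A₁ d₁)
    (hd : IsSymmetrizer A d) (hA : IsGCM A)
    (hclosed : ClosedIn (φ '' realRoots A₁) (realRoots A)) (hL : LinearMap.range φ = ⊤) :
    weylGroup A ≤ subWeylGroup A d φ := by
  refine (Subgroup.closure_le _).2 ?_
  rintro w ⟨i, hi⟩
  obtain ⟨x, hx⟩ := LinearMap.range_eq_top.1 hL (simpleRoot i)
  refine hφ.reflection_mem_subWeylGroup hA₁.symmetrizer hA₁.gcm hd hA (x := x) ?_ ?_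
  · refine hφ.preimage_realRoots_subset hA₁ hd hA hclosed ?_
    rw [Set.mem_preimage, hx]
    exact simpleRoot_mem_realRoots A i
  · rw [hx]
    exact hd.isReflectionIn_simpleRoot hA hi

theorem reflectionGroup_realRoots_inter_range (hφ : IsRootSystemIn A d A₁ d₁ φ)
    (hA : IsHyperbolic A d) (hd₁ : IsSymmetrizer A₁ d₁) (hA₁ : IsGCM A₁)
    (hmin : IsMinimalDecomposition A d φ) (hL : LinearMap.range φ < ⊤) :
    reflectionGroup A d (realRoots A ∩ LinearMap.range φ) = subWeylGroup A d φ := by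
  refine hmin.2 _ (isReflectionGroup_reflectionGroup A d _) (reflectionGroup_mono ?_)
    (hA.reflectionGroup_realRoots_inter_lt hL)
  exact Set.subset_inter
    ((range_simpleRoot_subset A₁ φ).trans (hφ.image_realRoots_subset hd₁ hA₁))
    (Set.range_subset_iff.2 fun j => ⟨_, rfl⟩)

theorem realRoots_inter_range_subset (hφ : IsRootSystemIn A d A₁ d₁ φ)
    (hA : IsHyperbolic A d) (hd₁ : IsSymmetrizer A₁ d₁) (hA₁ : IsGCM A₁)
    (hmin : IsMinimalDecomposition A d φ) (hL : LinearMap.range φ < ⊤) :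
    realRoots A ∩ LinearMap.range φ ⊆ φ '' realRoots A₁ := by
  intro y hy
  obtain ⟨s, -, hs⟩ := hA.symmetrizer.exists_isReflectionIn hA.gcm hy.1
  refine (hφ.isReflectionStable hd₁ hA₁).mem_of_reflection_mem hA
    (hφ.image_realRoots_subset hd₁ hA₁) hy.1 hs
    (reflectionGroup_mono (range_simpleRoot_subset A₁ φ) ?_)
  change s ∈ subWeylGroup A d φ
  rw [← hφ.reflectionGroup_realRoots_inter_range hA hd₁ hA₁ hmin hL]
  exact reflection_mem_reflectionGroup hy hs

theorem image_roots_eq (hφ : IsRootSystemIn A d A₁ d₁ φ) (hA : IsHyperbolic A d)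
    (hd₁ : IsSymmetrizer A₁ d₁) (hA₁ : IsGCM A₁) (hmin : IsMinimalDecomposition A d φ)
    (hL : LinearMap.range φ < ⊤) : φ '' roots A₁ d₁ = roots A d ∩ LinearMap.range φ := by
  refine (Set.subset_inter hφ.subset ?_).antisymm ?_
  · rintro _ ⟨x, -, rfl⟩
    exact ⟨x, rfl⟩
  rintro y ⟨hy | hy, hyL⟩
  · exact Set.image_mono Set.subset_union_left
      (hφ.realRoots_inter_range_subset hA hd₁ hA₁ hmin hL ⟨hy, hyL⟩)
  · obtain ⟨x, rfl⟩ := hyL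
    exact ⟨x, .inr (hφ.map_mem_imagRoots_iff.1 hy), rfl⟩

end IsRootSystemIn

end HypRoot

theorem lemma1 {ι κ : Type*} [Fintype ι] [DecidableEq ι] [Fintype κ] [DecidableEq κ]
    (A : Matrix ι ι ℤ) (d : ι → ℝ) (hA : HypRoot.IsHyperbolic A d)
    (A₁ : Matrix κ κ ℤ) (d₁ : κ → ℝ) (hA₁ : HypRoot.IsHyperbolic A₁ d₁)
    (φ : (κ → ℤ) →ₗ[ℤ] (ι → ℤ)) (hφ : HypRoot.IsRootSystemIn A d A₁ d₁ φ)
    (hmin : HypRoot.IsMinimalDecomposition A d φ) :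
    [ LinearMap.range φ < ⊤,
      φ '' HypRoot.roots A₁ d₁ = HypRoot.roots A d ∩ (LinearMap.range φ : Set (ι → ℤ)),
      HypRoot.ClosedIn (φ '' HypRoot.roots A₁ d₁) (HypRoot.roots A d),
      HypRoot.ClosedIn (φ '' HypRoot.realRoots A₁) (HypRoot.realRoots A) ].TFAE := by
  tfae_have 1 → 2 := hφ.image_roots_eq hA hA₁.symmetrizer hA₁.gcm hmin
  tfae_have 2 → 3 := fun h => h ▸ HypRoot.ClosedIn.inter _ (LinearMap.range φ)
  tfae_have 3 → 4 := hφ.closedIn_realRoots hA.symmetrizer hA.gcm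
  tfae_have 4 → 1 := fun h => lt_top_iff_ne_top.2 fun hL =>
    hmin.1.not_ge (hφ.weylGroup_le_subWeylGroup hA₁ hA.symmetrizer hA.gcm h hL)
  tfae_finish
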